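/- **Setting.** Let $(\Omega,\mathcal F,\mathbb P)$ be a probability space, $\mathcal V=\{1,\dots,N\}$ a set of nodes and $x_0\in\mathbb R^n$ an unknown deterministic parameter. For $k\ge 0$ let $\mathcal A_{\mathcal G(k)}=[w_{ij}(k)]_{N\times N}$ be a random real weighted adjacency matrix with zero diagonal of a digraph $\mathcal G(k)$ on $\mathcal V$, where $\mathcal N_i(k)=\{j: w_{ij}(k)\ne 0\}$ is the set of in-neighbours of $i$. Let $\mathcal L_{\mathcal G(k)}=\mathcal D_{\mathcal G(k)}-\mathcal A_{\mathcal G(k)}$ be its Laplacian, where $\mathcal D_{\mathcal G(k)}=\mathrm{diag}\big(\sum_j w_{1j}(k),\dots,\sum_j w_{Nj}(k)\big)$, and let $\widehat{\mathcal L}_{\mathcal G(k)}=\frac12(\mathcal L_{\mathcal G(k)}+\mathcal L_{\mathcal G(k)}^T)$. Node $i$ observes $$y_i(k)=H_i(k)x_0+v_i(k),$$ with random regression matrix $H_i(k)\in\mathbb R^{n_i\times n}$ and measurement noise $v_i(k)\in\mathbb R^{n_i}$. It receives from $j\in\mathcal N_i(k)$ the vector $$\mu_{ji}(k)=x_j(k)+f_{ji}(x_j(k)-x_i(k))\,\xi_{ji}(k),$$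 with communication noise $\xi_{ji}(k)\in\mathbb R^n$ and a Borel noise intensity function $f_{ji}:\mathbb R^n\to\mathbb R$. From deterministic initial values $x_i(0)\in\mathbb R^n$, the estimates are produced by $$x_i(k+1)=x_i(k)+a(k)H_i^T(k)\big(y_i(k)-H_i(k)x_i(k)\big)+b(k)\sum_{j\in\mathcal N_i(k)}w_{ij}(k)\big(\mu_{ji}(k)-x_i(k)\big)-\lambda(k)x_i(k),\qquad k\ge0,\ i\in\mathcal V,$$ with gains $a(k),b(k),\lambda(k)\ge 0$. Let $\mathcal H(k)=\mathrm{diag}(H_1(k),\dots,H_N(k))$ (block diagonal), let $v(k)$ and $\xi(k)$ be the stacked vectors of all $v_i(k)$ and of all $\xi_{ji}(k)$ $(j,i\in\mathcal V)$, and let $\mathcal F(k)=\sigma(\mathcal A_{\mathcal G(s)},H_i(s),v_i(s),\xi_{ji}(s):\ i,j\in\mathcal V,\ 0\le s\le k)$, with $\mathcal F(-1)$ trivial. Write $\|\cdot\|$ for the Euclidean norm of vectors and the spectral norm of matrices, and $\lambda_{\min}$ for the smallest eigenvalue of a symmetric matrix. For integers $h\ge1$, $k\ge0$ put $$\Lambda_k^h=\lambda_{\min}\Big[\sum_{i=kh}^{(k+1)h-1}\Big(b(i)\,\mathbb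 E\big[\widehat{\mathcal L}_{\mathcal G(i)}\,|\,\mathcal F(kh-1)\big]\otimes I_n+a(i)\,\mathbb E\big[\mathcal H^T(i)\mathcal H(i)\,|\,\mathcal F(kh-1)\big]\Big)\Big].$$ **Theorem.** Assume: (A1) there are constants $\sigma,b$ with $|f_{ji}(x)|\le\sigma\|x\|+b$ for all $x\in\mathbb R^n$ and all $i,j$; (A2) $\{v(k),\mathcal F(k)\}_{k\ge0}$ and $\{\xi(k),\mathcal F(k)\}_{k\ge0}$ are martingale difference sequences, the noise process $\{(v(k),\xi(k))\}_{k\ge0}$ is independent of $\{(\mathcal H(k),\mathcal A_{\mathcal G(k)})\}_{k\ge0}$, and there is a constant $\beta_v$ with $\sup_{k\ge0}\mathbb E[\|v(k)\|^2+\|\xi(k)\|^2\,|\,\mathcal F(k-1)]\le\beta_v$ a.s. Suppose that $a(k),b(k),\lambda(k)$ are monotonically decreasing (in the weak sense) and that there exist a positive integer $h$ and a constant $\rho_0>0$ such that (i) $\sum_{k=0}^\infty\Lambda_k^h=\infty$ a.s., and $\inf_{k\ge0}(\Lambda_k^h+\lambda(k))\ge0$ a.s.; (ii) $\sum_{k=0}^\infty\big(a^2(k)+b^2(k)+\lambda(k)\big)<\infty$;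 (iii) $\sup_{k\ge0}\Big(\|\mathcal L_{\mathcal G(k)}\|+\big(\mathbb E\big[\|\mathcal H^T(k)\mathcal H(k)\|^{2^{\max\{h,2\}}}\,\big|\,\mathcal F(k-1)\big]\big)^{2^{-\max\{h,2\}}}\Big)\le\rho_0$ a.s. Then, almost surely, $\lim_{k\to\infty}x_i(k)=x_0$ for every $i\in\mathcal V$. -/

import Mathlib

open MeasureTheory ProbabilityTheory Filter Topology
open scoped Matrix Kronecker

noncomputable section

namespace DecentralizedRegression

/-- The data of the decentralized online regularized linear regression problem over `N` nodes:
parameter dimension `n`, measurement dimension `m i` at node `i`, sample space `Ω`.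
No law is built in except that weighted adjacency matrices have zero diagonal.
The weights are arbitrary real numbers. -/
structure Model (Ω : Type*) (N n : ℕ) (m : Fin N → ℕ) where
  /-- random weighted adjacency matrix `[w_ij(k)]` of the digraph at time `k` -/
  adj : ℕ → Ω → Matrix (Fin N) (Fin N) ℝ
  adj_diag : ∀ k ω i, adj k ω i i = 0
  /-- random regression matrix `H_i(k)` -/
  H : (i : Fin N) → ℕ → Ω → Matrix (Fin (m i)) (Fin n) ℝ
  /-- measurement noise `v_i(k)` -/
  v : (i : Fin N) → ℕ → Ω → EuclideanSpace ℝ (Fin (m i))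
  /-- communication noise `ξ_ji(k)` on the channel from node `j` to node `i` (first argument `j`) -/
  ξ : Fin N → Fin N → ℕ → Ω → EuclideanSpace ℝ (Fin n)
  /-- noise intensity function `f_ji` (first argument `j`) -/
  f : Fin N → Fin N → EuclideanSpace ℝ (Fin n) → ℝ
  /-- innovation gain `a(k)` -/
  a : ℕ → ℝ
  /-- consensus gain `b(k)` -/
  b : ℕ → ℝ
  /-- regularization gain `λ(k)` -/
  lam : ℕ → ℝ
  /-- true parameter vector -/
  x₀ : EuclideanSpace ℝ (Fin n)
  /-- (deterministic) initial estimates `x_i(0)` -/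
  init : Fin N → EuclideanSpace ℝ (Fin n)

/-- Spectral norm (operator 2-norm) of a real square matrix. -/
def specNorm {ι : Type*} [Fintype ι] [DecidableEq ι] (A : Matrix ι ι ℝ) : ℝ :=
  ‖Matrix.toEuclideanCLM (n := ι) (𝕜 := ℝ) A‖

/-- Smallest eigenvalue of a real symmetric matrix: the least element of its (finite, real)
spectrum. -/
def lambdaMin {ι : Type*} [Fintype ι] [DecidableEq ι] (A : Matrix ι ι ℝ) : ℝ :=
  sInf (spectrum ℝ A)

/-- Entrywise conditional expectation of a random matrix. -/
def condExpMat {Ω ι κ : Type*} {mΩ : MeasurableSpace Ω} (μ : Measure Ω) (F : MeasurableSpace Ω)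
    (A : Ω → Matrix ι κ ℝ) (ω : Ω) : Matrix ι κ ℝ :=
  Matrix.of fun p q => (μ[fun ω' => A ω' p q | F]) ω

namespace Model

variable {Ω : Type*} {N n : ℕ} {m : Fin N → ℕ} (S : Model Ω N n m)

/-- In-neighbours of node `i` at time `k`: the nodes `j` for which `(j, i)` is an edge,
that is, `w_ij(k) ≠ 0`. -/
def nbrs (k : ℕ) (ω : Ω) (i : Fin N) : Finset (Fin N) :=
  Finset.univ.filter fun j => S.adj k ω i j ≠ 0

/-- Laplacian matrix: diagonal matrix of in-degrees minus the weighted adjacency matrix. -/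
def lap (k : ℕ) (ω : Ω) : Matrix (Fin N) (Fin N) ℝ :=
  Matrix.diagonal (fun i => ∑ j, S.adj k ω i j) - S.adj k ω

/-- Symmetrized Laplacian. -/
def symLap (k : ℕ) (ω : Ω) : Matrix (Fin N) (Fin N) ℝ :=
  (1 / 2 : ℝ) • (S.lap k ω + (S.lap k ω)ᵀ)

/-- Block diagonal matrix `diag(H_1(k), …, H_N(k))`, with columns indexed by `Fin N × Fin n`. -/
def bigH (k : ℕ) (ω : Ω) : Matrix (Σ i : Fin N, Fin (m i)) (Fin N × Fin n) ℝ :=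
  (Matrix.blockDiagonal' fun i => S.H i k ω).submatrix id
    (Equiv.sigmaEquivProd (Fin N) (Fin n)).symm

/-- The Gram matrix of `bigH`. -/
def gram (k : ℕ) (ω : Ω) : Matrix (Fin N × Fin n) (Fin N × Fin n) ℝ :=
  (S.bigH k ω)ᵀ * S.bigH k ω

/-- Observation `y_i(k) = H_i(k) x₀ + v_i(k)`. -/
def obs (i : Fin N) (k : ℕ) (ω : Ω) : EuclideanSpace ℝ (Fin (m i)) :=
  Matrix.toEuclideanLin (S.H i k ω) S.x₀ + S.v i k ω

/-- What node `i` receives from node `j` at time `k` when the current estimates are `x`. -/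
def received (x : Fin N → EuclideanSpace ℝ (Fin n)) (j i : Fin N) (k : ℕ) (ω : Ω) :
    EuclideanSpace ℝ (Fin n) :=
  x j + S.f j i (x j - x i) • S.ξ j i k ω

/-- The estimates produced by the algorithm: `est k ω i` is `x_i(k)`. -/
def est : ℕ → Ω → Fin N → EuclideanSpace ℝ (Fin n)
  | 0, _, i => S.init i
  | k + 1, ω, i =>
      est k ω i
        + S.a k • Matrix.toEuclideanLin (S.H i k ω)ᵀ
            (S.obs i k ω - Matrix.toEuclideanLin (S.H i k ω) (est k ω i))
        + S.b k • ∑ j ∈ S.nbrs k ω i,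
            S.adj k ω i j • (S.received (est k ω) j i k ω - est k ω i)
        - S.lam k • est k ω i

/-- σ-algebra generated by the graph and the regression matrices at time `s`. -/
abbrev sigmaGH (s : ℕ) : MeasurableSpace Ω :=
  (⨆ (i : Fin N) (j : Fin N), (borel ℝ).comap fun ω => S.adj s ω i j) ⊔
    ⨆ (i : Fin N) (p : Fin (m i)) (q : Fin n), (borel ℝ).comap fun ω => S.H i s ω p q

/-- σ-algebra generated by the measurement and communication noises at time `s`. -/
abbrev sigmaNoise (s : ℕ) : MeasurableSpace Ω :=
  (⨆ i : Fin N, (borel _).comap (S.v i s)) ⊔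
    ⨆ (j : Fin N) (i : Fin N), (borel _).comap (S.ξ j i s)

/-- `past k` is the σ-algebra `F(k - 1)` generated by everything at times `s < k`;
`past 0` is the trivial σ-algebra `F(-1)`. -/
abbrev past (k : ℕ) : MeasurableSpace Ω :=
  ⨆ (s : ℕ) (_ : s < k), S.sigmaGH s ⊔ S.sigmaNoise s

/-- Squared norm of all noises at time `k`: `‖v(k)‖² + ‖ξ(k)‖²` for the stacked vectors. -/
def noiseSq (k : ℕ) (ω : Ω) : ℝ :=
  ∑ i, ‖S.v i k ω‖ ^ 2 + ∑ j, ∑ i, ‖S.ξ j i k ω‖ ^ 2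

/-- All random elements are random variables, and the intensity functions are Borel. -/
structure IsMeasurable [MeasurableSpace Ω] : Prop where
  adj : ∀ k i j, Measurable fun ω => S.adj k ω i j
  H : ∀ i k p q, Measurable fun ω => S.H i k ω p q
  v : ∀ i k, Measurable (S.v i k)
  ξ : ∀ j i k, Measurable (S.ξ j i k)
  f : ∀ j i, Measurable (S.f j i)

/-- The noise intensity functions grow at most linearly. -/
def LinearGrowth : Prop :=
  ∃ σ b : ℝ, ∀ j i x, |S.f j i x| ≤ σ * ‖x‖ + b

/-- Both noises are martingale differences for the filtration generated by all the data, jointly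
independent of the graphs and regression matrices, and have uniformly bounded conditional second
moments. Integrability is spelled out since `μ[· | ·]` is `0` on non-integrable functions. -/
structure NoiseCondition [MeasurableSpace Ω] (μ : Measure Ω) : Prop where
  integrable_v : ∀ i k, Integrable (S.v i k) μ
  integrable_ξ : ∀ j i k, Integrable (S.ξ j i k) μ
  condExp_v : ∀ i k, μ[S.v i k | S.past k] =ᵐ[μ] 0
  condExp_ξ : ∀ j i k, μ[S.ξ j i k | S.past k] =ᵐ[μ] 0
  indep : Indep (⨆ s, S.sigmaNoise s) (⨆ s, S.sigmaGH s) μ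
  integrable_sq : ∀ k, Integrable (S.noiseSq k) μ
  bounded : ∃ β : ℝ, ∀ k, ∀ᵐ ω ∂μ, (μ[S.noiseSq k | S.past k]) ω ≤ β

/-- The quantity `Λ_k^h`: the smallest eigenvalue of the information matrix over the time window
`kh ≤ i < (k+1)h`, conditioned on `F(kh - 1)`. -/
def infoEig [MeasurableSpace Ω] (μ : Measure Ω) (h k : ℕ) (ω : Ω) : ℝ :=
  lambdaMin (∑ i ∈ Finset.Ico (k * h) ((k + 1) * h),
    (S.b i • (condExpMat μ (S.past (k * h)) (S.symLap i) ω ⊗ₖ (1 : Matrix (Fin n) (Fin n) ℝ))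
      + S.a i • condExpMat μ (S.past (k * h)) (S.gram i) ω))

/-- The power of `‖𝓗ᵀ(k)𝓗(k)‖` (exponent `2 ^ max h 2`) whose conditional moments are bounded. -/
def gramPow (h k : ℕ) (ω : Ω) : ℝ :=
  specNorm (S.gram k ω) ^ (2 ^ max h 2)

end Model

end DecentralizedRegression

end

/-! Idea of the proof. Stack the errors into `err`, written δ(k). Since rows of a Laplacian sum to
zero, δ(k+1) = δ(k) - G(k) δ(k) + e(k) - λ(k)(δ(k) + c), where G(k) = b(k) 𝓛(k) ⊗ I + a(k)
𝓗ᵀ(k)𝓗(k), c stacks N copies of x₀, and e(k) is linear in the noises (`err_succ`). Put ε(k) = (a(k)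
+ b(k))² + λ(k), which is summable.

A single step need not decrease ‖δ‖², because G(k) has no sign; only its conditional mean over a
window of length h is controlled. So the state is frozen at the start of a window. Within a window δ
moves by O(ε) in conditional mean square, relative to 1 + ‖δ‖², and replacing δ(kh + i) by δ(kh) in
the quadratic form of the drift costs an error of the same order (`exists_displacement_le`,
`exists_drift_ge`). Summing over the window (`exists_energy_le`), the conditional mean of
‖δ((k+1)h)‖² is at most ‖δ(kh)‖² minus twice the conditional quadratic form of the summed drift,
plus O(ε(kh))(1 + ‖δ(kh)‖²). That form is at least Λ_k ‖δ(kh)‖² (`infoEig_mul_le`), as quadratic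
forms see only the symmetric part of the Laplacian.

Λ_k may be negative, but Λ_k + λ(k) is not, and adding λ(k)‖δ(kh)‖² costs a summable perturbation.
Then `robbins_siegmund` makes ‖δ(kh)‖² converge and ∑ (Λ_k + λ(k)) ‖δ(kh)‖² finite. As ∑ Λ_k
diverges, the limit is zero. Displacements inside windows are square summable almost surely, so the
whole sequence tends to zero (`tendsto_zero`).

The probabilistic obstacle is that noise at time k is multiplied by H(k) and the weights at time k,
which do not belong to the past. Independence of the noises from the design allows conditioning on
the past noises together with the whole design without changing conditional moments of the current
noise (`condExp_pastNoiseAndDesign`). -/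

namespace DecentralizedRegression

/-! ### Conditional moment bounds for products, and almost supermartingales. -/

section Probability

variable {Ω : Type*} {m mΩ : MeasurableSpace Ω} {μ : Measure Ω} [IsFiniteMeasure μ]

/-- The product of a nonnegative integrable `m`-measurable variable with a nonnegative variable
whose conditional expectation given `m` is bounded is integrable. -/
lemma integrable_mul_of_condExp_le (hm : m ≤ mΩ) {X Y : Ω → ℝ} {C : ℝ}
    (hX : StronglyMeasurable[m] X) (hXi : Integrable X μ) (hX0 : ∀ ω, 0 ≤ X ω)
    (hYi : Integrable Y μ) (hY0 : ∀ᵐ ω ∂μ, 0 ≤ Y ω) (hC : ∀ᵐ ω ∂μ, (μ[Y | m]) ω ≤ C) :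
    Integrable (fun ω => X ω * Y ω) μ := by
  have hYm : AEMeasurable (fun ω => ENNReal.ofReal (Y ω)) μ := hYi.1.aemeasurable.ennreal_ofReal
  have hXm : Measurable[m] fun ω => ENNReal.ofReal (X ω) := hX.measurable.ennreal_ofReal
  -- The product is not yet known to be integrable, so no factor can be pulled out of a conditional
  -- expectation. Instead the bound on `μ[Y | m]` is read as a comparison of measures on `m`: the
  -- measure with density `Y` is at most `C • μ` there, and `X` is integrated against both.
  have hle : (μ.withDensity fun ω => ENNReal.ofReal (Y ω)).trim hm
      ≤ ENNReal.ofReal C • μ.trim hm := by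
    refine Measure.le_iff.2 fun A hA => ?_
    rw [Measure.smul_apply, trim_measurableSet_eq hm hA, trim_measurableSet_eq hm hA,
      withDensity_apply _ (hm A hA),
      ← ofReal_integral_eq_lintegral_ofReal hYi.integrableOn (ae_restrict_of_ae hY0),
      ← setIntegral_condExp hm hYi hA, smul_eq_mul]
    by_cases hμA : μ A = 0
    · rw [setIntegral_measure_zero _ hμA]; simp
    have h1 : ∫ ω in A, (μ[Y | m]) ω ∂μ ≤ ∫ _ in A, C ∂μ :=
      setIntegral_mono_ae integrable_condExp.integrableOn (integrable_const _).integrableOn hC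
    rw [setIntegral_const, smul_eq_mul] at h1
    refine (ENNReal.ofReal_le_ofReal h1).trans ?_
    rw [ENNReal.ofReal_mul measureReal_nonneg, ofReal_measureReal, mul_comm]
  refine ⟨hXi.1.mul hYi.1, ?_⟩
  rw [hasFiniteIntegral_iff_ofReal]
  · have : ∫⁻ ω, ENNReal.ofReal (X ω * Y ω) ∂μ
        = ∫⁻ ω, ENNReal.ofReal (X ω) ∂(μ.withDensity fun ω => ENNReal.ofReal (Y ω)) := by
      rw [lintegral_withDensity_eq_lintegral_mul₀ hYm (hXm.mono hm le_rfl).aemeasurable]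
      refine lintegral_congr fun ω => ?_
      rw [ENNReal.ofReal_mul (hX0 ω), mul_comm]; rfl
    rw [this, ← lintegral_trim hm hXm]
    refine (lintegral_mono' hle le_rfl).trans_lt ?_
    rw [lintegral_smul_measure, lintegral_trim hm hXm, smul_eq_mul]
    refine ENNReal.mul_lt_top ENNReal.ofReal_lt_top ?_
    exact (hasFiniteIntegral_iff_ofReal (ae_of_all _ hX0)).1 hXi.2
  · filter_upwards [hY0] with ω h using mul_nonneg (hX0 ω) h

lemma setIntegral_mul_le_of_condExp_le (hm : m ≤ mΩ) {X Y : Ω → ℝ} {C : ℝ}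
    (hX : StronglyMeasurable[m] X) (hXi : Integrable X μ) (hX0 : ∀ ω, 0 ≤ X ω)
    (hYi : Integrable Y μ) (hY0 : ∀ᵐ ω ∂μ, 0 ≤ Y ω) (hC : ∀ᵐ ω ∂μ, (μ[Y | m]) ω ≤ C)
    {A : Set Ω} (hA : MeasurableSet[m] A) :
    ∫ ω in A, X ω * Y ω ∂μ ≤ C * ∫ ω in A, X ω ∂μ := by
  have hXY := integrable_mul_of_condExp_le hm hX hXi hX0 hYi hY0 hC
  rw [← setIntegral_condExp hm hXY hA, ← integral_const_mul]
  refine setIntegral_mono_ae integrable_condExp.integrableOn (hXi.const_mul C).integrableOn ?_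
  filter_upwards [condExp_mul_of_stronglyMeasurable_left hX hXY hYi, hC] with ω h1 h2
  change (μ[X * Y | m]) ω ≤ _
  rw [h1, Pi.mul_apply, mul_comm]
  exact mul_le_mul_of_nonneg_right h2 (hX0 ω)

end Probability

/-- The Robbins–Siegmund almost supermartingale theorem with deterministic summable
perturbations. -/
theorem robbins_siegmund {Ω : Type*} {mΩ : MeasurableSpace Ω} {μ : Measure Ω}
    [IsFiniteMeasure μ] (F : Filtration ℕ mΩ) {V D : ℕ → Ω → ℝ} {α : ℕ → ℝ}
    (hα0 : ∀ k, 0 ≤ α k) (hα : Summable α)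
    (hV : ∀ k, StronglyMeasurable[F k] (V k)) (hVi : ∀ k, Integrable (V k) μ)
    (hV0 : ∀ k ω, 0 ≤ V k ω)
    (hD : ∀ k, StronglyMeasurable[F k] (D k)) (hDi : ∀ k, Integrable (D k) μ)
    (hD0 : ∀ᵐ ω ∂μ, ∀ k, 0 ≤ D k ω)
    (hVD : ∀ k A, MeasurableSet[F k] A →
      ∫ ω in A, V (k + 1) ω ∂μ ≤ ∫ ω in A, ((1 + α k) * V k ω - D k ω + α k) ∂μ) :
    (∀ᵐ ω ∂μ, (∃ l, Tendsto (fun k => V k ω) atTop (𝓝 l)) ∧ Summable fun k => D k ω) ∧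
      ∃ M, ∀ k, ∫ ω, V k ω ∂μ ≤ M := by
  -- Dividing by `p k` removes the factors `1 + α k`; summability of `α` keeps `p` between 1 and
  -- `P`.
  set p : ℕ → ℝ := fun k => ∏ i ∈ Finset.range k, (1 + α i) with hp
  have hp1 : ∀ k, 1 ≤ p k := fun k => by
    induction k with
    | zero => simp [hp]
    | succ k ih =>
      have : p (k + 1) = p k * (1 + α k) := Finset.prod_range_succ _ _
      rw [this]; nlinarith [hα0 k]
  have hp0 : ∀ k, 0 < p k := fun k => lt_of_lt_of_le one_pos (hp1 k)
  have hps : ∀ k, p (k + 1) = p k * (1 + α k) := fun k => Finset.prod_range_succ _ _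
  have hpP : ∀ k, p k ≤ Real.exp (∑' i, α i) := fun k => by
    refine le_trans (b := Real.exp (∑ i ∈ Finset.range k, α i)) ?_
      (Real.exp_le_exp.2 (hα.sum_le_tsum _ fun i _ => hα0 i))
    rw [Real.exp_sum]
    refine Finset.prod_le_prod (fun i _ => by linarith [hα0 i]) fun i _ => ?_
    rw [add_comm]; exact Real.add_one_le_exp _
  set P := Real.exp (∑' i, α i)
  obtain ⟨pl, hpl⟩ : ∃ l, Tendsto p atTop (𝓝 l) := by
    refine ⟨_, tendsto_atTop_ciSup (monotone_nat_of_le_succ fun k => ?_) ⟨P, ?_⟩⟩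
    · rw [hps]; nlinarith [hα0 k, hp0 k]
    · rintro _ ⟨k, rfl⟩; exact hpP k
  have hαp : Summable fun i => α i / p (i + 1) :=
    Summable.of_nonneg_of_le (fun i => div_nonneg (hα0 i) (hp0 _).le)
      (fun i => div_le_self (hα0 i) (hp1 _)) hα
  set T := ∑' i, α i / p (i + 1)
  have hT : ∀ k, ∑ i ∈ Finset.range k, α i / p (i + 1) ≤ T := fun k =>
    hαp.sum_le_tsum _ fun i _ => div_nonneg (hα0 i) (hp0 _).le
  -- The discounted value, plus what has been dissipated, minus the perturbations paid so far: a
  -- supermartingale bounded below by `-T`.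
  set W : ℕ → Ω → ℝ := fun k ω => V k ω / p k + ∑ i ∈ Finset.range k, D i ω / p (i + 1)
    - ∑ i ∈ Finset.range k, α i / p (i + 1) with hW
  have hWi : ∀ k, Integrable (W k) μ := fun k =>
    (((hVi k).div_const _).add (integrable_finsetSum _ fun i _ => (hDi i).div_const _)).sub
      (integrable_const _)
  have hWs : ∀ k ω, W (k + 1) ω = W k ω
      + (V (k + 1) ω - ((1 + α k) * V k ω - D k ω + α k)) / p (k + 1) := fun k ω => by
    have h1 := (hp0 k).ne'
    have h2 : 1 + α k ≠ 0 := by linarith [hα0 k]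
    simp only [hW, Finset.sum_range_succ, hps k]
    field_simp
    ring
  have hsuper : Supermartingale W F μ := by
    refine supermartingale_of_setIntegral_succ_le (fun k => ?_) hWi fun k A hA => ?_
    · refine (((hV k).measurable.div_const _).stronglyMeasurable.add ?_).sub stronglyMeasurable_const
      refine Finset.stronglyMeasurable_fun_sum _ fun i hi => ?_
      exact (((hD i).mono (F.mono (Finset.mem_range.1 hi).le)).measurable.div_const _).stronglyMeasurable
    · have hi2 : Integrable (fun ω => (1 + α k) * V k ω - D k ω + α k) μ :=
        (((hVi k).const_mul _).sub (hDi k)).add (integrable_const _)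
      have h3 : Integrable (fun ω => (V (k + 1) ω - ((1 + α k) * V k ω - D k ω + α k))
          / p (k + 1)) μ := ((hVi _).sub hi2).div_const _
      rw [integral_congr_ae (ae_of_all _ (hWs k)), integral_add (hWi k).integrableOn
        h3.integrableOn, integral_div, integral_sub (hVi _).integrableOn hi2.integrableOn]
      have := div_nonpos_of_nonpos_of_nonneg (sub_nonpos.2 (hVD k A hA)) (hp0 (k + 1)).le
      linarith
  have hlow : ∀ᵐ ω ∂μ, ∀ k, V k ω / p k - T ≤ W k ω := by
    filter_upwards [hD0] with ω h k
    have : 0 ≤ ∑ i ∈ Finset.range k, D i ω / p (i + 1) :=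
      Finset.sum_nonneg fun i _ => div_nonneg (h i) (hp0 _).le
    simp only [hW]; linarith [hT k]
  have hEW : ∀ k, ∫ ω, W k ω ∂μ ≤ ∫ ω, W 0 ω ∂μ := fun k => by
    simpa using hsuper.setIntegral_le (Nat.zero_le k) MeasurableSet.univ
  have hT0 : 0 ≤ T := by simpa using hT 0
  -- Since `W ≥ -T`, one has `|W| ≤ W + 2T`, and the mean of `W` does not exceed its initial value.
  -- This is the `L¹` bound needed for martingale convergence of `-W`.
  set R := ∫ ω, W 0 ω ∂μ + 2 * T * μ.real Set.univ
  have hbd : ∀ k, eLpNorm ((-W) k) 1 μ ≤ (Real.toNNReal R : ENNReal) := fun k => by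
    rw [Pi.neg_apply, eLpNorm_neg, eLpNorm_one_eq_lintegral_enorm,
      ← ofReal_integral_norm_eq_lintegral_enorm (hWi k)]
    change _ ≤ ENNReal.ofReal R
    refine ENNReal.ofReal_le_ofReal ?_
    have : ∫ ω, ‖W k ω‖ ∂μ ≤ ∫ ω, (W k ω + 2 * T) ∂μ := by
      refine integral_mono_ae (hWi k).norm ((hWi k).add (integrable_const _)) ?_
      filter_upwards [hlow] with ω h
      have h1 := h k
      have h2 : 0 ≤ V k ω / p k := div_nonneg (hV0 k ω) (hp0 k).le
      rw [Real.norm_eq_abs, abs_le]; constructor <;> linarith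
    rw [integral_add (hWi k) (integrable_const _), integral_const, smul_eq_mul] at this
    have := hEW k
    simp only [R]; linarith
  refine ⟨?_, P * (R + T * μ.real Set.univ), fun k => ?_⟩
  · filter_upwards [hsuper.neg.exists_ae_tendsto_of_bdd hbd, hD0, hlow] with ω ⟨l, hl⟩ hDω hlowω
    have hWl : Tendsto (fun k => W k ω) atTop (𝓝 (-l)) := by simpa using hl.neg
    obtain ⟨B, hB⟩ := hWl.bddAbove_range
    have hsumD : Summable fun i => D i ω / p (i + 1) := by
      refine summable_of_sum_range_le (c := B + T) (fun i => div_nonneg (hDω i) (hp0 _).le)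
        fun k => ?_
      have h1 : W k ω ≤ B := hB ⟨k, rfl⟩
      have h2 : 0 ≤ V k ω / p k := div_nonneg (hV0 k ω) (hp0 k).le
      simp only [hW] at h1
      linarith [hT k]
    -- Solving the definition of `W` for `V` expresses `V` through convergent sequences.
    have h1 := ((hWl.sub hsumD.hasSum.tendsto_sum_nat).add hαp.hasSum.tendsto_sum_nat).mul hpl
    refine ⟨⟨_, h1.congr fun k => ?_⟩, ?_⟩
    · have := (hp0 k).ne'
      simp only [hW]; field_simp; ring
    · refine Summable.of_nonneg_of_le hDω (fun i => ?_) (hsumD.mul_left P)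
      have h1 : 0 ≤ D i ω / p (i + 1) := div_nonneg (hDω i) (hp0 _).le
      calc D i ω = p (i + 1) * (D i ω / p (i + 1)) := by field_simp [(hp0 (i + 1)).ne']
        _ ≤ _ := mul_le_mul_of_nonneg_right (hpP _) h1
  · have h1 : ∫ ω, V k ω / p k ∂μ ≤ ∫ ω, (W k ω + T) ∂μ := by
      refine integral_mono_ae ((hVi k).div_const _) ((hWi k).add (integrable_const _)) ?_
      filter_upwards [hlow] with ω h
      have := h k
      linarith
    rw [integral_add (hWi k) (integrable_const _), integral_const, smul_eq_mul, integral_div,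
      div_le_iff₀ (hp0 k)] at h1
    have h0 : 0 ≤ ∫ ω, V k ω ∂μ := integral_nonneg (hV0 k)
    have h3 : 0 ≤ μ.real Set.univ := measureReal_nonneg
    have h2 : ∫ ω, W k ω ∂μ + μ.real Set.univ * T ≤ R + T * μ.real Set.univ := by
      have := hEW k
      have := mul_nonneg hT0 h3
      simp only [R]; linarith
    have h4 : 0 ≤ R + T * μ.real Set.univ := by
      refine le_trans ?_ h2
      by_contra hneg
      have := mul_neg_of_neg_of_pos (not_le.1 hneg) (hp0 k)
      linarith
    calc _ ≤ _ := h1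
      _ ≤ (R + T * μ.real Set.univ) * p k := mul_le_mul_of_nonneg_right h2 (hp0 k).le
      _ ≤ (R + T * μ.real Set.univ) * P := mul_le_mul_of_nonneg_left (hpP k) h4
      _ = _ := mul_comm _ _

/-! ### Energy estimates for an abstract perturbed linear recursion. -/

/-- A process in a Hilbert space driven by random linear drifts `G`, noises `e` and a vanishing
regularization, with the conditional moment bounds used in the convergence analysis. -/
structure IsPerturbedRecursion {Ω E : Type*} {mΩ : MeasurableSpace Ω} [NormedAddCommGroup E]
    [InnerProductSpace ℝ E] [MeasurableSpace E] (μ : Measure Ω) (F : Filtration ℕ mΩ)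
    (δ e : ℕ → Ω → E) (G : ℕ → Ω → E →L[ℝ] E) (s : ℕ → Ω → ℝ) (c : E) (η lam : ℕ → ℝ)
    (C : ℝ) : Prop where
  recursion : ∀ k ω, δ (k + 1) ω = δ k ω - G k ω (δ k ω) + e k ω - lam k • (δ k ω + c)
  adapted : ∀ k, Measurable[F k] (δ k)
  integrable_zero : Integrable (fun ω => ‖δ 0 ω‖ ^ 2) μ
  measurable_noise : ∀ k, Measurable (e k)
  measurable_drift : ∀ k (X : Ω → E), Measurable X → Measurable fun ω => G k ω (X ω)
  one_le : ∀ k ω, 1 ≤ s k ω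
  integrable_scale : ∀ k, Integrable (fun ω => s k ω ^ 2) μ
  condExp_scale : ∀ k, ∀ᵐ ω ∂μ, (μ[fun ω => s k ω ^ 2 | F k]) ω ≤ C
  norm_drift : ∀ᵐ ω ∂μ, ∀ k x, ‖G k ω x‖ ≤ η k * s k ω * ‖x‖
  -- The noise conditions presuppose a finite second moment of the state, since that is itself
  -- obtained by induction from them. Conditional estimates take the form of integrals over `F
  -- k`-measurable sets, which can be added and chained across times without almost sure exceptional
  -- sets.
  integrable_noise : ∀ k, Integrable (fun ω => ‖δ k ω‖ ^ 2) μ →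
    Integrable (fun ω => ‖e k ω‖ ^ 2) μ
  noise_le : ∀ k, Integrable (fun ω => ‖δ k ω‖ ^ 2) μ → ∀ A, MeasurableSet[F k] A →
    ∫ ω in A, ‖e k ω‖ ^ 2 ∂μ ≤ C * η k ^ 2 * ∫ ω in A, (1 + ‖δ k ω‖ ^ 2) ∂μ
  noise_orthogonal : ∀ k, Integrable (fun ω => ‖δ k ω‖ ^ 2) μ → ∀ A, MeasurableSet[F k] A →
    ∫ ω in A, inner ℝ (δ k ω) (e k ω) ∂μ = 0
  const_nonneg : 0 ≤ C
  gain_nonneg : ∀ k, 0 ≤ η k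
  lam_nonneg : ∀ k, 0 ≤ lam k
  gain_antitone : Antitone η
  lam_antitone : Antitone lam

namespace IsPerturbedRecursion

set_option linter.unusedSectionVars false

variable {Ω E : Type*} {mΩ : MeasurableSpace Ω} [NormedAddCommGroup E]
    [InnerProductSpace ℝ E] [MeasurableSpace E] [BorelSpace E] [SecondCountableTopology E]
    {μ : Measure Ω} [IsFiniteMeasure μ] {F : Filtration ℕ mΩ}
    {δ e : ℕ → Ω → E} {G : ℕ → Ω → E →L[ℝ] E} {s : ℕ → Ω → ℝ} {c : E} {η lam : ℕ → ℝ} {C : ℝ}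
    (R : IsPerturbedRecursion μ F δ e G s c η lam C)

include R

lemma measurable (k : ℕ) : Measurable (δ k) := (R.adapted k).mono (F.le k) le_rfl

lemma norm_step_sq_le : ∀ᵐ ω ∂μ, ∀ k, ‖δ (k + 1) ω - δ k ω‖ ^ 2 ≤
    3 * η k ^ 2 * (‖δ k ω‖ ^ 2 * s k ω ^ 2) + 3 * ‖e k ω‖ ^ 2
      + 6 * lam k ^ 2 * (1 + ‖c‖ ^ 2) * (1 + ‖δ k ω‖ ^ 2) := by
  filter_upwards [R.norm_drift] with ω hG k
  have h1 : δ (k + 1) ω - δ k ω = - G k ω (δ k ω) + e k ω - lam k • (δ k ω + c) := by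
    rw [R.recursion]; abel
  have h2 : ‖δ (k + 1) ω - δ k ω‖ ≤ η k * s k ω * ‖δ k ω‖ + ‖e k ω‖
      + lam k * (‖δ k ω‖ + ‖c‖) := by
    rw [h1]
    refine (norm_sub_le _ _).trans (add_le_add ((norm_add_le _ _).trans ?_) ?_)
    · rw [norm_neg]; exact add_le_add_left (hG k _) _
    · rw [norm_smul, Real.norm_of_nonneg (R.lam_nonneg k)]
      exact mul_le_mul_of_nonneg_left (norm_add_le _ _) (R.lam_nonneg k)
  have h3 : ∀ x y z : ℝ, (x + y + z) ^ 2 ≤ 3 * x ^ 2 + 3 * y ^ 2 + 3 * z ^ 2 := fun x y z => by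
    nlinarith [sq_nonneg (x - y), sq_nonneg (y - z), sq_nonneg (x - z)]
  have h4 : (‖δ k ω‖ + ‖c‖) ^ 2 ≤ 2 * ((1 + ‖c‖ ^ 2) * (1 + ‖δ k ω‖ ^ 2)) := by
    nlinarith [sq_nonneg (‖δ k ω‖ - ‖c‖), mul_nonneg (sq_nonneg ‖c‖) (sq_nonneg ‖δ k ω‖)]
  have h5 := mul_le_mul_of_nonneg_left h4 (sq_nonneg (lam k))
  calc _ ≤ _ := pow_le_pow_left₀ (norm_nonneg _) h2 2
    _ ≤ _ := h3 _ _ _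
    _ ≤ _ := by nlinarith

/-- The scale at time `k` is not `F k`-measurable, but any state up to time `k` is; conditioning on
`F k` lets `s k ^ 2` be replaced by its bound `C`. -/
lemma integrable_mul_scale {i k : ℕ} (hik : i ≤ k) {X : Ω → E} (hX : Measurable[F i] X)
    (hXi : Integrable (fun ω => ‖X ω‖ ^ 2) μ) :
    Integrable (fun ω => ‖X ω‖ ^ 2 * s k ω ^ 2) μ :=
  integrable_mul_of_condExp_le (F.le k)
    (((measurable_norm.pow_const 2).comp (hX.mono (F.mono hik) le_rfl)).stronglyMeasurable) hXi
    (fun _ => sq_nonneg _) (R.integrable_scale k) (ae_of_all _ fun _ => sq_nonneg _)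
    (R.condExp_scale k)

lemma setIntegral_mul_scale_le {i k : ℕ} (hik : i ≤ k) {X : Ω → E} (hX : Measurable[F i] X)
    (hXi : Integrable (fun ω => ‖X ω‖ ^ 2) μ) {A : Set Ω} (hA : MeasurableSet[F k] A) :
    ∫ ω in A, ‖X ω‖ ^ 2 * s k ω ^ 2 ∂μ ≤ C * ∫ ω in A, ‖X ω‖ ^ 2 ∂μ :=
  setIntegral_mul_le_of_condExp_le (F.le k)
    (((measurable_norm.pow_const 2).comp (hX.mono (F.mono hik) le_rfl)).stronglyMeasurable) hXi
    (fun _ => sq_nonneg _) (R.integrable_scale k) (ae_of_all _ fun _ => sq_nonneg _)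
    (R.condExp_scale k) hA

omit R in
lemma integrable_sq_of_sub {X Y : Ω → E}
    (hXi : Integrable (fun ω => ‖X ω‖ ^ 2) μ)
    (hYi : Integrable (fun ω => ‖Y ω - X ω‖ ^ 2) μ) (hY : Measurable Y) :
    Integrable (fun ω => ‖Y ω‖ ^ 2) μ := by
  refine ((hXi.const_mul 2).add (hYi.const_mul 2)).mono' (hY.norm.pow_const 2).aestronglyMeasurable
    (ae_of_all _ fun ω => ?_)
  have : ‖Y ω‖ ≤ ‖X ω‖ + ‖Y ω - X ω‖ := by
    simpa using norm_add_le (X ω) (Y ω - X ω)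
  rw [Real.norm_of_nonneg (sq_nonneg _)]
  change _ ≤ 2 * ‖X ω‖ ^ 2 + 2 * ‖Y ω - X ω‖ ^ 2
  nlinarith [sq_nonneg (‖X ω‖ - ‖Y ω - X ω‖), norm_nonneg (Y ω)]

lemma integrable_step_aux {k : ℕ} (hk : Integrable (fun ω => ‖δ k ω‖ ^ 2) μ) :
    Integrable (fun ω => ‖δ (k + 1) ω - δ k ω‖ ^ 2) μ := by
  refine ((((R.integrable_mul_scale le_rfl (R.adapted k) hk).const_mul (3 * η k ^ 2)).add
    ((R.integrable_noise k hk).const_mul 3)).add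
    (((integrable_const 1).add hk).const_mul (6 * lam k ^ 2 * (1 + ‖c‖ ^ 2)))).mono'
    (((R.measurable _).sub (R.measurable k)).norm.pow_const 2).aestronglyMeasurable ?_
  filter_upwards [R.norm_step_sq_le] with ω h
  rw [Real.norm_of_nonneg (sq_nonneg _)]
  exact h k

lemma integrable_sq (k : ℕ) : Integrable (fun ω => ‖δ k ω‖ ^ 2) μ := by
  induction k with
  | zero => exact R.integrable_zero
  | succ k ih =>
    exact integrable_sq_of_sub ih (R.integrable_step_aux ih) (R.measurable _)

lemma integrable_one_add_sq (k : ℕ) : Integrable (fun ω => 1 + ‖δ k ω‖ ^ 2) μ :=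
  (integrable_const 1).add (R.integrable_sq k)

lemma integrable_sub_sq (i k : ℕ) : Integrable (fun ω => ‖δ i ω - δ k ω‖ ^ 2) μ := by
  have h1 := R.integrable_sq k
  refine integrable_sq_of_sub (X := δ i) (R.integrable_sq i) ?_
    ((R.measurable i).sub (R.measurable k))
  simpa using h1

lemma integrable_drift {i k : ℕ} (hik : i ≤ k) :
    Integrable (fun ω => inner ℝ (δ i ω) (G k ω (δ i ω))) μ := by
  refine ((R.integrable_mul_scale hik (R.adapted i) (R.integrable_sq i)).const_mul (η k)).mono'
    ((R.measurable i).inner (R.measurable_drift k _ (R.measurable i))).aestronglyMeasurable ?_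
  filter_upwards [R.norm_drift] with ω h
  refine (norm_inner_le_norm _ _).trans ?_
  have h1 := mul_le_mul_of_nonneg_left (h k (δ i ω)) (norm_nonneg (δ i ω))
  -- The normalization `1 ≤ s` makes the square of the scale dominate its first power, so one moment
  -- condition serves every term.
  have h2 : s k ω ≤ s k ω ^ 2 := by nlinarith [R.one_le k ω]
  have h3 := mul_le_mul_of_nonneg_left h2
    (mul_nonneg (R.gain_nonneg k) (sq_nonneg ‖δ i ω‖))
  linarith

lemma integrable_inner_noise (k : ℕ) : Integrable (fun ω => inner ℝ (δ k ω) (e k ω)) μ := by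
  refine ((R.integrable_sq k).add (R.integrable_noise k (R.integrable_sq k))).mono'
    ((R.measurable k).inner (R.measurable_noise k)).aestronglyMeasurable (ae_of_all _ fun ω => ?_)
  refine (norm_inner_le_norm _ _).trans ?_
  change _ ≤ ‖δ k ω‖ ^ 2 + ‖e k ω‖ ^ 2
  nlinarith [sq_nonneg (‖δ k ω‖ - ‖e k ω‖), sq_nonneg ‖δ k ω‖, sq_nonneg ‖e k ω‖]

lemma setIntegral_sq_le (k : ℕ) (A : Set Ω) :
    ∫ ω in A, ‖δ k ω‖ ^ 2 ∂μ ≤ ∫ ω in A, (1 + ‖δ k ω‖ ^ 2) ∂μ :=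
  integral_mono (R.integrable_sq k).integrableOn (R.integrable_one_add_sq k).integrableOn
    fun ω => by simp

omit R [MeasurableSpace E] [BorelSpace E] [SecondCountableTopology E] [IsFiniteMeasure μ] in
lemma setIntegral_one_add_sq_nonneg (k : ℕ) (A : Set Ω) :
    0 ≤ ∫ ω in A, (1 + ‖δ k ω‖ ^ 2) ∂μ :=
  integral_nonneg fun _ => add_nonneg zero_le_one (sq_nonneg _)

/-- Conditional mean square size of one step. -/
lemma exists_step_le : ∃ M, 0 ≤ M ∧ ∀ k A, MeasurableSet[F k] A →
    ∫ ω in A, ‖δ (k + 1) ω - δ k ω‖ ^ 2 ∂μ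
      ≤ M * (η k ^ 2 + lam k) * ∫ ω in A, (1 + ‖δ k ω‖ ^ 2) ∂μ := by
  have hC := R.const_nonneg
  have hl := R.lam_nonneg
  refine ⟨6 * C + 6 * lam 0 * (1 + ‖c‖ ^ 2),
    add_nonneg (by positivity) (mul_nonneg (mul_nonneg (by norm_num) (hl 0)) (by positivity)),
    fun k A hA => ?_⟩
  have i1 := (R.integrable_mul_scale le_rfl (R.adapted k) (R.integrable_sq k)).const_mul
    (3 * η k ^ 2)
  have i2 := (R.integrable_noise k (R.integrable_sq k)).const_mul 3
  have i3 := (R.integrable_one_add_sq k).const_mul (6 * lam k ^ 2 * (1 + ‖c‖ ^ 2))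
  have h1 := setIntegral_mono_ae (s := A) (R.integrable_sub_sq (k + 1) k).integrableOn
    ((i1.fun_add i2).fun_add i3).integrableOn
    (R.norm_step_sq_le.mono fun ω h => h k)
  rw [integral_add (i1.fun_add i2).integrableOn i3.integrableOn,
    integral_add i1.integrableOn i2.integrableOn, integral_const_mul, integral_const_mul,
    integral_const_mul] at h1
  have h2 := R.setIntegral_mul_scale_le le_rfl (R.adapted k) (R.integrable_sq k) hA
  have h3 := R.noise_le k (R.integrable_sq k) A hA
  have h4 := R.setIntegral_sq_le k A
  have h5 := setIntegral_one_add_sq_nonneg (μ := μ) (δ := δ) k A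
  set w := ∫ ω in A, (1 + ‖δ k ω‖ ^ 2) ∂μ
  -- Monotonicity turns the quadratic contribution of the regularization into one linear in `lam k`,
  -- which is all that is summable by hypothesis.
  have h6 : lam k ^ 2 ≤ lam 0 * lam k := by
    rw [sq]; exact mul_le_mul_of_nonneg_right (R.lam_antitone (Nat.zero_le k)) (hl k)
  have h7 := mul_le_mul_of_nonneg_left (h2.trans (mul_le_mul_of_nonneg_left h4 hC))
    (by positivity : 0 ≤ 3 * η k ^ 2)
  have h8 := mul_le_mul_of_nonneg_right h6 (mul_nonneg (by positivity : 0 ≤ 6 * (1 + ‖c‖ ^ 2)) h5)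
  have h9 : 0 ≤ C * lam k * w := mul_nonneg (mul_nonneg hC (hl k)) h5
  have h10 : 0 ≤ lam 0 * (1 + ‖c‖ ^ 2) * η k ^ 2 * w :=
    mul_nonneg (mul_nonneg (mul_nonneg (hl 0) (by positivity)) (sq_nonneg _)) h5
  nlinarith

lemma eps_nonneg (k : ℕ) : 0 ≤ η k ^ 2 + lam k := add_nonneg (sq_nonneg _) (R.lam_nonneg k)

lemma eps_antitone : Antitone fun k => η k ^ 2 + lam k := fun _ j hij =>
  add_le_add (pow_le_pow_left₀ (R.gain_nonneg j) (R.gain_antitone hij) 2) (R.lam_antitone hij)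

lemma setIntegral_one_add_sq_le (i k : ℕ) (A : Set Ω) :
    ∫ ω in A, (1 + ‖δ i ω‖ ^ 2) ∂μ
      ≤ 2 * ∫ ω in A, (1 + ‖δ k ω‖ ^ 2) ∂μ + 2 * ∫ ω in A, ‖δ i ω - δ k ω‖ ^ 2 ∂μ := by
  rw [← integral_const_mul, ← integral_const_mul, ← integral_add
    ((R.integrable_one_add_sq k).const_mul 2).integrableOn
    ((R.integrable_sub_sq i k).const_mul 2).integrableOn]
  refine integral_mono (R.integrable_one_add_sq i).integrableOn
    (((R.integrable_one_add_sq k).const_mul 2).add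
      ((R.integrable_sub_sq i k).const_mul 2)).integrableOn fun ω => ?_
  have : ‖δ i ω‖ ≤ ‖δ k ω‖ + ‖δ i ω - δ k ω‖ := by
    simpa using norm_add_le (δ k ω) (δ i ω - δ k ω)
  change 1 + _ ≤ 2 * (1 + ‖δ k ω‖ ^ 2) + 2 * _
  nlinarith [sq_nonneg (‖δ k ω‖ - ‖δ i ω - δ k ω‖), norm_nonneg (δ i ω)]

/-- Conditional mean square displacement over `j` steps. -/
lemma exists_displacement_le (j : ℕ) : ∃ M, 0 ≤ M ∧ ∀ k A, MeasurableSet[F k] A →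
    ∫ ω in A, ‖δ (k + j) ω - δ k ω‖ ^ 2 ∂μ
      ≤ M * (η k ^ 2 + lam k) * ∫ ω in A, (1 + ‖δ k ω‖ ^ 2) ∂μ := by
  obtain ⟨M₁, hM₁, h₁⟩ := R.exists_step_le
  induction j with
  | zero => exact ⟨0, le_rfl, fun k A _ => by simp⟩
  | succ j ih =>
    obtain ⟨M, hM, ih⟩ := ih
    have hε0 := R.eps_nonneg 0
    set ε₀ := η 0 ^ 2 + lam 0 with hε₀
    -- The factor `2 + 2 * M * ε₀` is the price of comparing `1 + ‖δ (k + j)‖²` with `1 + ‖δ k‖²` in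
    -- the mean, by the induction hypothesis.
    refine ⟨2 * M + 2 * M₁ * (2 + 2 * M * ε₀), by positivity, fun k A hA => ?_⟩
    have hA' : MeasurableSet[F (k + j)] A := F.mono (Nat.le_add_right k j) _ hA
    have e1 := ih k A hA
    have e2 := h₁ (k + j) A hA'
    have e3 := R.setIntegral_one_add_sq_le (k + j) k A
    have e4 := setIntegral_one_add_sq_nonneg (μ := μ) (δ := δ) k A
    have i1 := (R.integrable_sub_sq (k + j + 1) (k + j)).const_mul 2
    have i2 := (R.integrable_sub_sq (k + j) k).const_mul 2
    have e5 : ∫ ω in A, ‖δ (k + j + 1) ω - δ k ω‖ ^ 2 ∂μ ≤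
        2 * ∫ ω in A, ‖δ (k + j + 1) ω - δ (k + j) ω‖ ^ 2 ∂μ
        + 2 * ∫ ω in A, ‖δ (k + j) ω - δ k ω‖ ^ 2 ∂μ := by
      rw [← integral_const_mul, ← integral_const_mul,
        ← integral_add i1.integrableOn i2.integrableOn]
      refine integral_mono (R.integrable_sub_sq _ _).integrableOn (i1.fun_add i2).integrableOn
        fun ω => ?_
      have : ‖δ (k + j + 1) ω - δ k ω‖
          ≤ ‖δ (k + j + 1) ω - δ (k + j) ω‖ + ‖δ (k + j) ω - δ k ω‖ := by
        simpa using norm_add_le (δ (k + j + 1) ω - δ (k + j) ω) (δ (k + j) ω - δ k ω)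
      change _ ≤ 2 * _ + 2 * _
      nlinarith [sq_nonneg (‖δ (k + j + 1) ω - δ (k + j) ω‖ - ‖δ (k + j) ω - δ k ω‖),
        norm_nonneg (δ (k + j + 1) ω - δ k ω)]
    have hε := R.eps_antitone (Nat.le_add_right k j)
    have hεk := R.eps_antitone (Nat.zero_le k)
    have hεk0 := R.eps_nonneg k
    simp only at hε hεk
    set ε := η k ^ 2 + lam k
    set w := ∫ ω in A, (1 + ‖δ k ω‖ ^ 2) ∂μ
    have e6 : ∫ ω in A, (1 + ‖δ (k + j) ω‖ ^ 2) ∂μ ≤ (2 + 2 * M * ε₀) * w := by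
      have := mul_le_mul_of_nonneg_right (mul_le_mul_of_nonneg_left hεk hM) e4
      linarith
    have e7 : ∫ ω in A, ‖δ (k + j + 1) ω - δ (k + j) ω‖ ^ 2 ∂μ
        ≤ M₁ * ε * ((2 + 2 * M * ε₀) * w) :=
      e2.trans (mul_le_mul (mul_le_mul_of_nonneg_left hε hM₁) e6
        (setIntegral_one_add_sq_nonneg _ _) (by positivity))
    calc _ ≤ _ := e5
      _ ≤ 2 * (M₁ * ε * ((2 + 2 * M * ε₀) * w)) + 2 * (M * ε * w) := by linarith
      _ = _ := by ring

/-- Replacing the current state by the state `j` steps earlier in the quadratic form of the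
drift. -/
lemma exists_drift_ge (j : ℕ) : ∃ M, 0 ≤ M ∧ ∀ k A, MeasurableSet[F k] A →
    ∫ ω in A, inner ℝ (δ k ω) (G (k + j) ω (δ k ω)) ∂μ
      - M * (η k ^ 2 + lam k) * ∫ ω in A, (1 + ‖δ k ω‖ ^ 2) ∂μ
      ≤ ∫ ω in A, inner ℝ (δ (k + j) ω) (G (k + j) ω (δ (k + j) ω)) ∂μ := by
  obtain ⟨M, hM, hd⟩ := R.exists_displacement_le j
  have hC := R.const_nonneg
  have hη0 := R.gain_nonneg 0
  -- With `d` the displacement, the two cross terms are bounded by `η² s² ‖δ k‖² + ‖d‖²` and the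
  -- term quadratic in `d` by `η 0 * s² ‖d‖²`. These give `C`, `M` and `η 0 * C * M` respectively.
  refine ⟨C + (1 + η 0 * C) * M, by positivity, fun k A hA => ?_⟩
  have hA' : MeasurableSet[F (k + j)] A := F.mono (Nat.le_add_right k j) _ hA
  have hkj : k ≤ k + j := Nat.le_add_right k j
  have mδ : Measurable[F (k + j)] (δ k) := (R.adapted k).mono (F.mono hkj) le_rfl
  -- The displacement up to time `k + j` is known when `s (k + j)` is averaged, so the conditional
  -- moment bound applies to their product.
  have md : Measurable[F (k + j)] fun ω => δ (k + j) ω - δ k ω := (R.adapted _).sub mδ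
  have j1 := R.integrable_mul_scale le_rfl mδ (R.integrable_sq k)
  have j2 := R.integrable_sub_sq (k + j) k
  have j3 := R.integrable_mul_scale le_rfl md j2
  have i0 := R.integrable_drift hkj
  have i1 := j1.const_mul (η k ^ 2)
  have i3 := j3.const_mul (η 0)
  have h1 : ∫ ω in A, inner ℝ (δ k ω) (G (k + j) ω (δ k ω)) ∂μ
      - (η k ^ 2 * ∫ ω in A, ‖δ k ω‖ ^ 2 * s (k + j) ω ^ 2 ∂μ
        + ∫ ω in A, ‖δ (k + j) ω - δ k ω‖ ^ 2 ∂μ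
        + η 0 * ∫ ω in A, ‖δ (k + j) ω - δ k ω‖ ^ 2 * s (k + j) ω ^ 2 ∂μ)
      ≤ ∫ ω in A, inner ℝ (δ (k + j) ω) (G (k + j) ω (δ (k + j) ω)) ∂μ := by
    rw [← integral_const_mul, ← integral_const_mul, ← integral_add i1.integrableOn j2.integrableOn,
      ← integral_add (i1.fun_add j2).integrableOn i3.integrableOn,
      ← integral_sub i0.integrableOn ((i1.fun_add j2).fun_add i3).integrableOn]
    refine setIntegral_mono_ae (i0.sub ((i1.fun_add j2).fun_add i3)).integrableOn
      (R.integrable_drift le_rfl).integrableOn ?_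
    filter_upwards [R.norm_drift] with ω hG
    set d := δ (k + j) ω - δ k ω with hd
    have hx : δ (k + j) ω = δ k ω + d := by rw [hd]; abel
    rw [hx, map_add, inner_add_left, inner_add_right, inner_add_right]
    have a1 := neg_le_of_abs_le (abs_real_inner_le_norm (δ k ω) (G (k + j) ω d))
    have a2 := neg_le_of_abs_le (abs_real_inner_le_norm d (G (k + j) ω (δ k ω)))
    have a3 := neg_le_of_abs_le (abs_real_inner_le_norm d (G (k + j) ω d))
    have b1 := mul_le_mul_of_nonneg_left (hG (k + j) d) (norm_nonneg (δ k ω))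
    have b2 := mul_le_mul_of_nonneg_left (hG (k + j) (δ k ω)) (norm_nonneg d)
    have b3 := mul_le_mul_of_nonneg_left (hG (k + j) d) (norm_nonneg d)
    have c1 := R.gain_antitone hkj
    have c2 := R.gain_antitone (Nat.zero_le (k + j))
    have c3 := R.gain_nonneg (k + j)
    have c4 := R.one_le (k + j) ω
    have d1 : η (k + j) ^ 2 ≤ η k ^ 2 := pow_le_pow_left₀ c3 c1 2
    have d2 : η (k + j) * s (k + j) ω ≤ η 0 * s (k + j) ω ^ 2 :=
      mul_le_mul c2 (by nlinarith) (by linarith) hη0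
    have f1 := mul_le_mul_of_nonneg_right d2 (sq_nonneg ‖d‖)
    have f2 := mul_le_mul_of_nonneg_right d1 (mul_nonneg (sq_nonneg ‖δ k ω‖)
      (sq_nonneg (s (k + j) ω)))
    have f3 := sq_nonneg (η (k + j) * s (k + j) ω * ‖δ k ω‖ - ‖d‖)
    linarith
  have h2 := R.setIntegral_mul_scale_le le_rfl mδ (R.integrable_sq k) hA'
  have h3 := R.setIntegral_mul_scale_le le_rfl md j2 hA'
  have h4 := hd k A hA
  have h5 := R.setIntegral_sq_le k A
  have h6 := setIntegral_one_add_sq_nonneg (μ := μ) (δ := δ) k A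
  set w := ∫ ω in A, (1 + ‖δ k ω‖ ^ 2) ∂μ
  have h7 := mul_le_mul_of_nonneg_left (h2.trans (mul_le_mul_of_nonneg_left h5 hC))
    (sq_nonneg (η k))
  have h8 := mul_le_mul_of_nonneg_left (h3.trans (mul_le_mul_of_nonneg_left h4 hC)) hη0
  have h9 : 0 ≤ C * lam k * w := mul_nonneg (mul_nonneg hC (R.lam_nonneg k)) h6
  linarith

/-- Expand the square of `δ k` plus its increment: the noise cross term integrates to zero by
orthogonality, and the squared increment is of order `η² + lam`. -/
lemma exists_energy_step_le : ∃ M, 0 ≤ M ∧ ∀ k A, MeasurableSet[F k] A →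
    ∫ ω in A, ‖δ (k + 1) ω‖ ^ 2 ∂μ ≤ ∫ ω in A, ‖δ k ω‖ ^ 2 ∂μ
      - 2 * ∫ ω in A, inner ℝ (δ k ω) (G k ω (δ k ω)) ∂μ
      + M * (η k ^ 2 + lam k) * ∫ ω in A, (1 + ‖δ k ω‖ ^ 2) ∂μ := by
  obtain ⟨M, hM, hs⟩ := R.exists_step_le
  refine ⟨M + 2 * ‖c‖ ^ 2, by positivity, fun k A hA => ?_⟩
  have i1 := R.integrable_sq k
  have i2 := (R.integrable_drift (le_refl k)).const_mul 2
  have i12 : Integrable (fun ω => ‖δ k ω‖ ^ 2 - 2 * inner ℝ (δ k ω) (G k ω (δ k ω))) μ :=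
    i1.sub i2
  have i3 := (R.integrable_inner_noise k).const_mul 2
  have i4 := R.integrable_sub_sq (k + 1) k
  have i5 := (R.integrable_one_add_sq k).const_mul (2 * lam k * ‖c‖ ^ 2)
  have h1 : ∫ ω in A, ‖δ (k + 1) ω‖ ^ 2 ∂μ ≤ ∫ ω in A, ‖δ k ω‖ ^ 2 ∂μ
      - 2 * ∫ ω in A, inner ℝ (δ k ω) (G k ω (δ k ω)) ∂μ
      + 2 * ∫ ω in A, inner ℝ (δ k ω) (e k ω) ∂μ
      + ∫ ω in A, ‖δ (k + 1) ω - δ k ω‖ ^ 2 ∂μ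
      + 2 * lam k * ‖c‖ ^ 2 * ∫ ω in A, (1 + ‖δ k ω‖ ^ 2) ∂μ := by
    rw [← integral_const_mul, ← integral_const_mul, ← integral_const_mul,
      ← integral_sub i1.integrableOn i2.integrableOn,
      ← integral_add i12.integrableOn i3.integrableOn,
      ← integral_add (i12.fun_add i3).integrableOn i4.integrableOn,
      ← integral_add ((i12.fun_add i3).fun_add i4).integrableOn i5.integrableOn]
    refine integral_mono (R.integrable_sq _).integrableOn
      (((i12.fun_add i3).fun_add i4).fun_add i5).integrableOn fun ω => ?_
    change _ ≤ ‖δ k ω‖ ^ 2 - 2 * _ + 2 * _ + _ + _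
    have e1 : ‖δ (k + 1) ω‖ ^ 2 = ‖δ k ω‖ ^ 2
        + 2 * inner ℝ (δ k ω) (δ (k + 1) ω - δ k ω) + ‖δ (k + 1) ω - δ k ω‖ ^ 2 := by
      rw [← norm_add_sq_real]; simp
    have e2 : δ (k + 1) ω - δ k ω = - G k ω (δ k ω) + e k ω - lam k • (δ k ω + c) := by
      rw [R.recursion]; abel
    have e3 : inner ℝ (δ k ω) (δ (k + 1) ω - δ k ω) = - inner ℝ (δ k ω) (G k ω (δ k ω))
        + inner ℝ (δ k ω) (e k ω) - lam k * (‖δ k ω‖ ^ 2 + inner ℝ (δ k ω) c) := by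
      rw [e2, inner_sub_right, inner_add_right, inner_neg_right, inner_smul_right,
        inner_add_right, real_inner_self_eq_norm_sq]
    have e4 := neg_le_of_abs_le (abs_real_inner_le_norm (δ k ω) c)
    -- Completing the square: the damping of the regularization is spent only on absorbing its bias
    -- towards `-c`.
    have e5 : -(‖δ k ω‖ ^ 2 + inner ℝ (δ k ω) c) ≤ ‖c‖ ^ 2 * (1 + ‖δ k ω‖ ^ 2) := by
      nlinarith [sq_nonneg (‖δ k ω‖ - ‖c‖), sq_nonneg ‖c‖,
        mul_nonneg (sq_nonneg ‖c‖) (sq_nonneg ‖δ k ω‖), sq_nonneg ‖δ k ω‖]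
    have e6 := mul_le_mul_of_nonneg_left e5 (R.lam_nonneg k)
    rw [e1, e3]
    linarith
  rw [R.noise_orthogonal k i1 A hA] at h1
  have h2 := hs k A hA
  have h3 := setIntegral_one_add_sq_nonneg (μ := μ) (δ := δ) k A
  have h4 : 0 ≤ ‖c‖ ^ 2 * η k ^ 2 * ∫ ω in A, (1 + ‖δ k ω‖ ^ 2) ∂μ := by positivity
  linarith

/-- Energy balance over a window of `j` steps. -/
lemma exists_energy_le (j : ℕ) : ∃ M, 0 ≤ M ∧ ∀ k A, MeasurableSet[F k] A →
    ∫ ω in A, ‖δ (k + j) ω‖ ^ 2 ∂μ ≤ ∫ ω in A, ‖δ k ω‖ ^ 2 ∂μ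
      - 2 * ∫ ω in A, ∑ i ∈ Finset.range j, inner ℝ (δ k ω) (G (k + i) ω (δ k ω)) ∂μ
      + M * (η k ^ 2 + lam k) * ∫ ω in A, (1 + ‖δ k ω‖ ^ 2) ∂μ := by
  obtain ⟨M₁, hM₁, h₁⟩ := R.exists_energy_step_le
  induction j with
  | zero => exact ⟨0, le_rfl, fun k A _ => by simp⟩
  | succ j ih =>
    obtain ⟨M, hM, ih⟩ := ih
    obtain ⟨M₂, hM₂, h₂⟩ := R.exists_drift_ge j
    obtain ⟨M₃, hM₃, h₃⟩ := R.exists_displacement_le j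
    have hε0 := R.eps_nonneg 0
    set ε₀ := η 0 ^ 2 + lam 0 with hε₀
    refine ⟨M + 2 * M₂ + M₁ * (2 + 2 * M₃ * ε₀), by positivity, fun k A hA => ?_⟩
    have hA' : MeasurableSet[F (k + j)] A := F.mono (Nat.le_add_right k j) _ hA
    have e1 := ih k A hA
    have e2 := h₁ (k + j) A hA'
    have e3 := R.setIntegral_one_add_sq_le (k + j) k A
    have e4 := setIntegral_one_add_sq_nonneg (μ := μ) (δ := δ) k A
    have e5 := h₂ k A hA
    have e6 := h₃ k A hA
    simp only [Finset.sum_range_succ]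
    rw [integral_add (integrable_finsetSum _ fun i _ =>
      R.integrable_drift (Nat.le_add_right k i)).integrableOn
      (R.integrable_drift (Nat.le_add_right k j)).integrableOn]
    have hε := R.eps_antitone (Nat.le_add_right k j)
    have hεk := R.eps_antitone (Nat.zero_le k)
    have hεk0 := R.eps_nonneg k
    simp only at hε hεk
    set ε := η k ^ 2 + lam k
    set w := ∫ ω in A, (1 + ‖δ k ω‖ ^ 2) ∂μ
    have e7 : ∫ ω in A, (1 + ‖δ (k + j) ω‖ ^ 2) ∂μ ≤ (2 + 2 * M₃ * ε₀) * w := by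
      have := mul_le_mul_of_nonneg_right (mul_le_mul_of_nonneg_left hεk hM₃) e4
      linarith
    have e8 : M₁ * (η (k + j) ^ 2 + lam (k + j)) * ∫ ω in A, (1 + ‖δ (k + j) ω‖ ^ 2) ∂μ
        ≤ M₁ * ε * ((2 + 2 * M₃ * ε₀) * w) :=
      mul_le_mul (mul_le_mul_of_nonneg_left hε hM₁) e7
        (setIntegral_one_add_sq_nonneg _ _) (by positivity)
    have e9 : M₁ * ε * ((2 + 2 * M₃ * ε₀) * w) = M₁ * (2 + 2 * M₃ * ε₀) * ε * w := by ring
    rw [← add_assoc]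
    linarith

end IsPerturbedRecursion

/-! ### From the energy balance to almost sure convergence. -/

/-- If `l k * v k` is summable, `l k ≥ 0`, `∑ l k = ∞` and `v` converges, the limit of `v ≥ 0`
is zero. -/
lemma limit_eq_zero_of_summable_mul {l v : ℕ → ℝ} {L : ℝ} (hl : ∀ k, 0 ≤ l k)
    (hv : ∀ k, 0 ≤ v k) (hs : Summable fun k => l k * v k)
    (hd : Tendsto (fun K => ∑ k ∈ Finset.range K, l k) atTop atTop)
    (hL : Tendsto v atTop (𝓝 L)) : L = 0 := by
  by_contra hne
  have hpos : 0 < L := lt_of_le_of_ne (ge_of_tendsto' hL hv) (Ne.symm hne)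
  obtain ⟨K, hK⟩ := eventually_atTop.1 (hL.eventually (lt_mem_nhds (half_lt_self hpos)))
  have : Summable l := by
    refine (summable_nat_add_iff K).1 (Summable.of_nonneg_of_le (fun k => hl _) (fun k => ?_)
      (((summable_nat_add_iff K).2 hs).mul_left (2 / L)))
    have h1 := mul_le_mul_of_nonneg_left (hK (k + K) (Nat.le_add_left _ _)).le (hl (k + K))
    calc l (k + K) = 2 / L * (l (k + K) * (L / 2)) := by field_simp
      _ ≤ _ := mul_le_mul_of_nonneg_left h1 (by positivity)
  exact not_tendsto_nhds_of_tendsto_atTop hd _ this.hasSum.tendsto_sum_nat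

namespace IsPerturbedRecursion

variable {Ω E : Type*} {mΩ : MeasurableSpace Ω} [NormedAddCommGroup E]
    [InnerProductSpace ℝ E] [MeasurableSpace E] [BorelSpace E] [SecondCountableTopology E]
    {μ : Measure Ω} [IsProbabilityMeasure μ] {F : Filtration ℕ mΩ}
    {δ e : ℕ → Ω → E} {G : ℕ → Ω → E →L[ℝ] E} {s : ℕ → Ω → ℝ} {c : E} {η lam : ℕ → ℝ} {C : ℝ}

/-- Convergence under persistence of excitation over windows of length `h`. -/
theorem tendsto_zero (R : IsPerturbedRecursion μ F δ e G s c η lam C) {h : ℕ} (hh : 0 < h)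
    (hsum : Summable fun k => η k ^ 2 + lam k) {Λ : ℕ → Ω → ℝ}
    (hΛ : ∀ k, ∀ᵐ ω ∂μ, Λ k ω * ‖δ (k * h) ω‖ ^ 2 ≤ (μ[fun ω => ∑ i ∈ Finset.range h,
      inner ℝ (δ (k * h) ω) (G (k * h + i) ω (δ (k * h) ω)) | F (k * h)]) ω)
    (hdiv : ∀ᵐ ω ∂μ, Tendsto (fun K : ℕ => ∑ k ∈ Finset.range K, Λ k ω) atTop atTop)
    (hinf : ∀ᵐ ω ∂μ, ∀ k, 0 ≤ Λ k ω + lam k) :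
    ∀ᵐ ω ∂μ, Tendsto (fun k => δ k ω) atTop (𝓝 0) := by
  obtain ⟨M, hM, hE⟩ := R.exists_energy_le h
  have hinj : Function.Injective fun k : ℕ => k * h := fun i j hij =>
    Nat.eq_of_mul_eq_mul_right hh hij
  have hεs : Summable fun k => η (k * h) ^ 2 + lam (k * h) := hsum.comp_injective hinj
  have hlam : Summable lam := Summable.of_nonneg_of_le R.lam_nonneg
    (fun k => le_add_of_nonneg_left (sq_nonneg _)) hsum
  set Q : ℕ → Ω → ℝ := fun k => μ[fun ω => ∑ i ∈ Finset.range h,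
      inner ℝ (δ (k * h) ω) (G (k * h + i) ω (δ (k * h) ω)) | F (k * h)] with hQ
  -- The term `2 * lam k` repays the multiple of `‖δ (k * h)‖²` added to `D` to make it nonnegative.
  -- The index is `k`, not `k * h`, to match `hinf`.
  set α : ℕ → ℝ := fun k => M * (η (k * h) ^ 2 + lam (k * h)) + 2 * lam k with hα
  set D : ℕ → Ω → ℝ := fun k ω => 2 * (Q k ω + lam k * ‖δ (k * h) ω‖ ^ 2) with hD
  have hQi : ∀ k, Integrable (Q k) μ := fun k => integrable_condExp
  have hsqm : ∀ k, StronglyMeasurable[F (k * h)] fun ω => ‖δ (k * h) ω‖ ^ 2 := fun k =>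
    ((measurable_norm.pow_const 2).comp (R.adapted (k * h))).stronglyMeasurable
  have hDi : ∀ k, Integrable (D k) μ := fun k =>
    ((hQi k).add ((R.integrable_sq _).const_mul _)).const_mul 2
  have hΛ' := ae_all_iff.2 hΛ
  have hDΛ : ∀ᵐ ω ∂μ, ∀ k, 0 ≤ (Λ k ω + lam k) * ‖δ (k * h) ω‖ ^ 2 ∧
      2 * ((Λ k ω + lam k) * ‖δ (k * h) ω‖ ^ 2) ≤ D k ω := by
    filter_upwards [hΛ', hinf] with ω h1 h2 k
    refine ⟨mul_nonneg (h2 k) (sq_nonneg _), ?_⟩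
    have := h1 k
    simp only [hD, hQ]
    linarith
  -- Robbins–Siegmund is applied to the process sampled at the starts of the windows.
  let Fh : Filtration ℕ mΩ := ⟨fun k => F (k * h), fun i j hij =>
    F.mono (Nat.mul_le_mul_right h hij), fun k => F.le _⟩
  obtain ⟨hconv, B, hB⟩ := robbins_siegmund (μ := μ) Fh (V := fun k ω => ‖δ (k * h) ω‖ ^ 2)
    (D := D) (α := α)
    (fun k => add_nonneg (mul_nonneg hM (R.eps_nonneg _)) (mul_nonneg two_pos.le (R.lam_nonneg k)))
    ((hεs.mul_left M).add (hlam.mul_left 2)) hsqm (fun k => R.integrable_sq _)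
    (fun _ _ => sq_nonneg _)
    (fun k => ((stronglyMeasurable_condExp.add ((hsqm k).const_mul _)).const_mul 2)) hDi
    (by filter_upwards [hDΛ] with ω h1 k using
      (mul_nonneg two_pos.le (h1 k).1).trans (h1 k).2)
    (fun k A hA => by
      have e1 := hE (k * h) A hA
      have iQ : Integrable (fun ω => ∑ i ∈ Finset.range h,
          inner ℝ (δ (k * h) ω) (G (k * h + i) ω (δ (k * h) ω))) μ :=
        integrable_finsetSum _ fun i _ => R.integrable_drift (Nat.le_add_right _ i)
      have e2 : ∫ ω in A, Q k ω ∂μ = _ := setIntegral_condExp (F.le (k * h)) iQ hA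
      rw [← e2] at e1
      rw [Nat.add_mul, one_mul]
      have i1 := R.integrable_sq (k * h)
      have e3 : ∫ ω in A, ((1 + α k) * ‖δ (k * h) ω‖ ^ 2 - D k ω + α k) ∂μ
          = ∫ ω in A, ‖δ (k * h) ω‖ ^ 2 ∂μ - 2 * ∫ ω in A, Q k ω ∂μ
            + M * (η (k * h) ^ 2 + lam (k * h)) * ∫ ω in A, (1 + ‖δ (k * h) ω‖ ^ 2) ∂μ
            + ∫ _ in A, 2 * lam k ∂μ := by
        have i12 : Integrable (fun ω => ‖δ (k * h) ω‖ ^ 2 - 2 * Q k ω) μ :=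
          i1.sub ((hQi k).const_mul 2)
        have i3 := (R.integrable_one_add_sq (k * h)).const_mul
          (M * (η (k * h) ^ 2 + lam (k * h)))
        rw [← integral_const_mul, ← integral_const_mul,
          ← integral_sub i1.integrableOn ((hQi k).const_mul 2).integrableOn,
          ← integral_add i12.integrableOn i3.integrableOn,
          ← integral_add (i12.fun_add i3).integrableOn (integrable_const _).integrableOn]
        refine integral_congr_ae (ae_of_all _ fun ω => ?_)
        simp only [hD, hα]
        ring
      rw [e3]
      have : 0 ≤ ∫ _ in A, 2 * lam k ∂μ :=
        integral_nonneg fun _ => mul_nonneg two_pos.le (R.lam_nonneg k)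
      linarith)
  -- The sampled second moments are bounded by `B`, so the mean square displacements inside windows
  -- have a finite sum; hence their squares are almost surely summable.
  have hdisp : ∀ᵐ ω ∂μ, ∀ j, Summable fun k => ‖δ (k * h + j) ω - δ (k * h) ω‖ ^ 2 := by
    refine ae_all_iff.2 fun j => ?_
    obtain ⟨M', hM', hd⟩ := R.exists_displacement_le j
    have hi := fun k => R.integrable_sub_sq (k * h + j) (k * h)
    have hbd : Summable fun k => ∫ ω, ‖δ (k * h + j) ω - δ (k * h) ω‖ ^ 2 ∂μ := by
      refine Summable.of_nonneg_of_le (fun k => integral_nonneg fun _ => sq_nonneg _) (fun k => ?_)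
        ((hεs.mul_left M').mul_right (1 + B))
      have h1 := hd (k * h) _ MeasurableSet.univ
      rw [setIntegral_univ, setIntegral_univ, integral_add (integrable_const _)
        (R.integrable_sq _)] at h1
      simp only [integral_const, probReal_univ, smul_eq_mul, mul_one] at h1
      refine h1.trans (mul_le_mul_of_nonneg_left ?_ (mul_nonneg hM' (R.eps_nonneg _)))
      linarith [hB k]
    have hfin : ∫⁻ ω, ∑' k, ENNReal.ofReal (‖δ (k * h + j) ω - δ (k * h) ω‖ ^ 2) ∂μ ≠ ⊤ := by
      rw [lintegral_tsum fun k => (hi k).1.aemeasurable.ennreal_ofReal]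
      simp_rw [← fun k => ofReal_integral_eq_lintegral_ofReal (hi k)
        (ae_of_all _ fun _ => sq_nonneg _)]
      rw [← ENNReal.ofReal_tsum_of_nonneg (fun k => integral_nonneg fun _ => sq_nonneg _) hbd]
      exact ENNReal.ofReal_ne_top
    filter_upwards [ae_lt_top' (AEMeasurable.tsum fun k =>
      (hi k).1.aemeasurable.ennreal_ofReal) hfin] with ω hω
    have := ENNReal.summable_toReal hω.ne
    simpa [ENNReal.toReal_ofReal, sq_nonneg] using this
  filter_upwards [hconv, hdisp, hDΛ, hdiv, hinf] with ω ⟨⟨l, hl⟩, hDs⟩ hdω hDω hdivω hinfω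
  -- Adding `lam k ≥ 0` to `Λ k` makes the weights nonnegative and keeps their sum divergent.
  have hl0 : l = 0 := by
    refine limit_eq_zero_of_summable_mul hinfω (fun k => sq_nonneg ‖δ (k * h) ω‖) ?_ ?_ hl
    · refine Summable.of_nonneg_of_le (fun k => (hDω k).1) (fun k => ?_) hDs
      have := hDω k
      linarith
    · refine tendsto_atTop_mono (fun K => ?_) hdivω
      exact Finset.sum_le_sum fun k _ => le_add_of_nonneg_right (R.lam_nonneg k)
  rw [hl0] at hl
  have hsqrt : ∀ u : ℕ → E, Tendsto (fun k => ‖u k‖ ^ 2) atTop (𝓝 0) →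
      Tendsto (fun k => ‖u k‖) atTop (𝓝 0) := fun u hu => by
    have := (Real.continuous_sqrt.tendsto 0).comp hu
    simpa [Function.comp_def, Real.sqrt_sq] using this
  have t1 := hsqrt _ hl
  have t2 : Tendsto (fun k => ∑ j ∈ Finset.range h, ‖δ (k * h + j) ω - δ (k * h) ω‖)
      atTop (𝓝 0) := by
    simpa using tendsto_finsetSum (Finset.range h) fun j _ =>
      hsqrt _ (hdω j).tendsto_atTop_zero
  -- The time `k` lies in window `k / h` at offset `k % h`, and both bounds vanish as the window
  -- index grows.
  have t3 := (t1.add t2).comp (Nat.tendsto_div_const_atTop hh.ne')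
  rw [add_zero] at t3
  refine squeeze_zero_norm (fun k => ?_) t3
  have e1 : k / h * h + k % h = k := Nat.div_add_mod' k h
  have e2 := Finset.single_le_sum (f := fun j => ‖δ (k / h * h + j) ω - δ (k / h * h) ω‖)
    (fun _ _ => norm_nonneg _) (Finset.mem_range.2 (Nat.mod_lt k hh))
  simp only [e1] at e2
  have e3 : ‖δ k ω‖ ≤ ‖δ (k / h * h) ω‖ + ‖δ k ω - δ (k / h * h) ω‖ := by
    simpa using norm_add_le (δ (k / h * h) ω) (δ k ω - δ (k / h * h) ω)
  exact e3.trans (add_le_add_right e2 _)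

end IsPerturbedRecursion

/-! ### Spectral norm and smallest eigenvalue. -/

section Matrix

variable {ι : Type*} [Fintype ι] [DecidableEq ι]

lemma specNorm_nonneg (A : Matrix ι ι ℝ) : 0 ≤ specNorm A := norm_nonneg _

lemma abs_entry_le_specNorm (A : Matrix ι ι ℝ) (i j : ι) : |A i j| ≤ specNorm A := by
  have h1 : A i j = inner ℝ (EuclideanSpace.single i (1 : ℝ))
      (Matrix.toEuclideanCLM (n := ι) (𝕜 := ℝ) A (EuclideanSpace.single j (1 : ℝ))) := by
    rw [Matrix.inner_toEuclideanCLM]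
    simp
  rw [h1]
  refine (abs_real_inner_le_norm _ _).trans ?_
  refine (mul_le_mul_of_nonneg_left (ContinuousLinearMap.le_opNorm _ _) (norm_nonneg _)).trans ?_
  simp [specNorm]

lemma specNorm_le_sum (A : Matrix ι ι ℝ) :
    specNorm A ≤ ∑ i, ∑ j, |A i j| * specNorm (Matrix.single i j (1 : ℝ)) := by
  unfold specNorm
  conv_lhs => rw [Matrix.matrix_eq_sum_single A]
  simp only [map_sum]
  refine (norm_sum_le _ _).trans (Finset.sum_le_sum fun i _ => (norm_sum_le _ _).trans
    (Finset.sum_le_sum fun j _ => ?_))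
  rw [show Matrix.single i j (A i j) = A i j • Matrix.single i j (1 : ℝ) by simp, map_smul,
    norm_smul, Real.norm_eq_abs]

lemma continuous_specNorm : Continuous (specNorm (ι := ι)) :=
  continuous_norm.comp (LinearMap.continuous_of_finiteDimensional
    ((Matrix.toEuclideanCLM (n := ι) (𝕜 := ℝ)).toAlgEquiv.toLinearMap))

lemma measurable_specNorm {Ω : Type*} [MeasurableSpace Ω] {A : Ω → Matrix ι ι ℝ}
    (hA : ∀ i j, Measurable fun ω => A ω i j) : Measurable fun ω => specNorm (A ω) := by
  have hc : Continuous fun u : ι → ι → ℝ => specNorm (Matrix.of u) :=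
    continuous_specNorm.comp continuous_id
  exact hc.measurable.comp (measurable_pi_iff.2 fun i => measurable_pi_iff.2 fun j => hA i j)

lemma inner_toEuclideanCLM_eq_sum (A : Matrix ι ι ℝ) (x : EuclideanSpace ℝ ι) :
    inner ℝ x (Matrix.toEuclideanCLM (n := ι) (𝕜 := ℝ) A x) = ∑ p, ∑ q, x p * x q * A p q := by
  rw [Matrix.inner_toEuclideanCLM]
  simp only [dotProduct, Matrix.mulVec, Finset.mul_sum]
  exact Finset.sum_congr rfl fun p _ => Finset.sum_congr rfl fun q _ => by ring

/-- The smallest eigenvalue bounds the quadratic form of a symmetric matrix from below. -/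
lemma lambdaMin_mul_le {A : Matrix ι ι ℝ} (hA : A.IsHermitian) (x : EuclideanSpace ℝ ι) :
    lambdaMin A * ‖x‖ ^ 2 ≤ inner ℝ x (Matrix.toEuclideanCLM (n := ι) (𝕜 := ℝ) A x) := by
  -- Subtracting the least spectral value shifts the spectrum into the nonnegative reals.
  have hB : (A - algebraMap ℝ _ (lambdaMin A)).PosSemidef := by
    refine Matrix.posSemidef_iff_isHermitian_and_spectrum_nonneg.2 ⟨?_, ?_⟩
    · refine hA.sub ?_
      rw [Algebra.algebraMap_eq_smul_one]
      exact Matrix.isHermitian_one.smul (IsSelfAdjoint.all _)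
    · rw [← spectrum.sub_singleton_eq]
      rintro _ ⟨y, hy, _, rfl, rfl⟩
      exact sub_nonneg.2 (csInf_le (Matrix.finite_real_spectrum).bddBelow hy)
  have h1 := hB.dotProduct_mulVec_nonneg x.ofLp
  rw [Matrix.inner_toEuclideanCLM]
  rw [Matrix.sub_mulVec, dotProduct_sub, Algebra.algebraMap_eq_smul_one, Matrix.smul_mulVec,
    Matrix.one_mulVec, dotProduct_smul, smul_eq_mul] at h1
  have h2 : ‖x‖ ^ 2 = x.ofLp ⬝ᵥ x.ofLp := by
    rw [EuclideanSpace.real_norm_sq_eq]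
    exact Finset.sum_congr rfl fun i _ => sq _
  rw [h2]
  simpa using h1

end Matrix

/-! ### Conditioning in the presence of an independent σ-algebra. -/

section Independence

variable {Ω : Type*} {m₁ m₂ mX mΩ : MeasurableSpace Ω} {μ : Measure Ω} [IsProbabilityMeasure μ]

lemma isPiSystem_inter_measurableSet : IsPiSystem {s : Set Ω | ∃ A B, MeasurableSet[m₁] A ∧
    MeasurableSet[m₂] B ∧ s = A ∩ B} := by
  rintro _ ⟨A, B, hA, hB, rfl⟩ _ ⟨A', B', hA', hB', rfl⟩ _
  exact ⟨A ∩ A', B ∩ B', hA.inter hA', hB.inter hB', Set.inter_inter_inter_comm _ _ _ _⟩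

lemma sup_eq_generateFrom_inter : m₁ ⊔ m₂ = MeasurableSpace.generateFrom
    {s : Set Ω | ∃ A B, MeasurableSet[m₁] A ∧ MeasurableSet[m₂] B ∧ s = A ∩ B} := by
  refine le_antisymm (sup_le (fun A hA => ?_) fun B hB => ?_) ?_
  · exact MeasurableSpace.measurableSet_generateFrom ⟨A, Set.univ, hA, .univ, by simp⟩
  · exact MeasurableSpace.measurableSet_generateFrom ⟨Set.univ, B, .univ, hB, by simp⟩
  · refine MeasurableSpace.generateFrom_le ?_
    rintro _ ⟨A, B, hA, hB, rfl⟩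
    exact MeasurableSet.inter ((le_sup_left : m₁ ≤ m₁ ⊔ m₂) _ hA)
      ((le_sup_right : m₂ ≤ m₁ ⊔ m₂) _ hB)

/-- Given `m₂`, the conditional expectation of `X` restricted to `A` is the constant `∫ ω in A, X ω
∂μ`; integrate it over `B`. -/
lemma setIntegral_inter_of_indep (hmX : mX ≤ mΩ) (hm₂ : m₂ ≤ mΩ) (hind : Indep mX m₂ μ)
    {X : Ω → ℝ} (hX : StronglyMeasurable[mX] X) (hXi : Integrable X μ) {A B : Set Ω}
    (hA : MeasurableSet[mX] A) (hB : MeasurableSet[m₂] B) :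
    ∫ ω in A ∩ B, X ω ∂μ = μ.real B * ∫ ω in A, X ω ∂μ := by
  have h1 := condExp_indep_eq hmX hm₂ (hX.indicator hA) hind
  have h2 := setIntegral_condExp hm₂ (hXi.indicator (hmX _ hA)) hB
  rw [setIntegral_congr_ae (g := fun _ => ∫ ω, A.indicator X ω ∂μ) (hm₂ _ hB)
    (h1.mono fun _ h _ => h), setIntegral_const, integral_indicator (hmX _ hA),
    setIntegral_indicator (hmX _ hA), Set.inter_comm] at h2
  exact h2.symm

/-- Conditioning additionally on an independent σ-algebra does not change a conditional
expectation. -/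
lemma condExp_sup_of_indep (hmX : mX ≤ mΩ) (hm₁ : m₁ ≤ mX) (hm₂ : m₂ ≤ mΩ)
    (hind : Indep mX m₂ μ) {X : Ω → ℝ} (hX : StronglyMeasurable[mX] X) (hXi : Integrable X μ) :
    μ[X | m₁ ⊔ m₂] =ᵐ[μ] μ[X | m₁] := by
  have hle : m₁ ⊔ m₂ ≤ mΩ := sup_le (hm₁.trans hmX) hm₂
  have hsm : StronglyMeasurable[m₁] (μ[X | m₁]) := stronglyMeasurable_condExp
  have hYi : Integrable (μ[X | m₁]) μ := integrable_condExp
  refine (ae_eq_condExp_of_forall_setIntegral_eq hle hXi (fun _ _ _ => hYi.integrableOn)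
    (fun s hs _ => ?_) (hsm.mono (le_sup_left : m₁ ≤ m₁ ⊔ m₂)).aestronglyMeasurable).symm
  -- The intersections `A ∩ B` form a π-system generating `m₁ ⊔ m₂`, and on them both sides factor
  -- through `μ.real B`.
  induction s, hs using MeasurableSpace.induction_on_inter
    (sup_eq_generateFrom_inter (m₁ := m₁) (m₂ := m₂)) isPiSystem_inter_measurableSet with
  | empty => simp
  | basic t ht =>
    obtain ⟨A, B, hA, hB, rfl⟩ := ht
    rw [setIntegral_inter_of_indep hmX hm₂ hind (hsm.mono hm₁) hYi (hm₁ _ hA) hB,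
      setIntegral_inter_of_indep hmX hm₂ hind hX hXi (hm₁ _ hA) hB,
      setIntegral_condExp (hm₁.trans hmX) hXi hA]
  | compl t ht ih =>
    rw [setIntegral_compl (hle _ ht) hYi, setIntegral_compl (hle _ ht) hXi,
      ih (measure_lt_top _ _),
      integral_condExp (hm₁.trans hmX)]
  | iUnion f hd hf ih =>
    rw [integral_iUnion (fun i => hle _ (hf i)) hd hYi.integrableOn,
      integral_iUnion (fun i => hle _ (hf i)) hd hXi.integrableOn]
    exact tsum_congr fun i => ih i (measure_lt_top _ _)

/-- If a σ-algebra lies between `m₁` and `m₁ ⊔ m₂` with `m₂` independent, it gives the same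
conditional expectation as `m₁ ⊔ m₂`. -/
lemma condExp_sup_eq_condExp_of_indep {m : MeasurableSpace Ω} (hmX : mX ≤ mΩ) (hm₁ : m₁ ≤ mX)
    (hm₂ : m₂ ≤ mΩ) (hind : Indep mX m₂ μ) (h₁ : m₁ ≤ m) (h₂ : m ≤ m₁ ⊔ m₂) {X : Ω → ℝ}
    (hX : StronglyMeasurable[mX] X) (hXi : Integrable X μ) :
    μ[X | m₁ ⊔ m₂] =ᵐ[μ] μ[X | m] := by
  have hle : m₁ ⊔ m₂ ≤ mΩ := sup_le (hm₁.trans hmX) hm₂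
  have h3 := condExp_sup_of_indep hmX hm₁ hm₂ hind hX hXi
  have h4 : μ[μ[X | m₁ ⊔ m₂] | m] =ᵐ[μ] μ[X | m] := condExp_condExp_of_le h₂ hle
  have h5 : μ[μ[X | m₁] | m] = μ[X | m₁] :=
    condExp_of_stronglyMeasurable (h₂.trans hle) (stronglyMeasurable_condExp.mono h₁)
      integrable_condExp
  have h6 := condExp_congr_ae (m := m) h3
  rw [h5] at h6
  exact h3.trans (h6.symm.trans h4)

lemma setIntegral_mul_eq_zero_of_condExp_eq_zero {m : MeasurableSpace Ω} (hm : m ≤ mΩ)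
    {X Y : Ω → ℝ} (hX : StronglyMeasurable[m] X) (hXY : Integrable (fun ω => X ω * Y ω) μ)
    (hYi : Integrable Y μ) (hY : μ[Y | m] =ᵐ[μ] 0) {A : Set Ω} (hA : MeasurableSet[m] A) :
    ∫ ω in A, X ω * Y ω ∂μ = 0 := by
  rw [← setIntegral_condExp hm hXY hA]
  refine integral_eq_zero_of_ae (ae_restrict_of_ae ?_)
  filter_upwards [condExp_mul_of_stronglyMeasurable_left hX hXY hYi, hY] with ω h1 h2
  change (μ[X * Y | m]) ω = _
  rw [h1, Pi.mul_apply, h2]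
  simp

end Independence

/-! ### The error recursion of the algorithm. -/

namespace Model

variable {Ω : Type*} {N n : ℕ} {m : Fin N → ℕ} (S : Model Ω N n m)

/-- Stacked estimation errors. -/
noncomputable def err (k : ℕ) (ω : Ω) : EuclideanSpace ℝ (Fin N × Fin n) :=
  WithLp.toLp 2 fun ip => S.est k ω ip.1 ip.2 - S.x₀ ip.2

/-- `N` stacked copies of the true parameter. -/
noncomputable def stackedParam : EuclideanSpace ℝ (Fin N × Fin n) :=
  WithLp.toLp 2 fun ip => S.x₀ ip.2

/-- Drift matrix `b(k) 𝓛(k) ⊗ I + a(k) 𝓗ᵀ(k)𝓗(k)` of the error recursion. -/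
noncomputable def driftMat (k : ℕ) (ω : Ω) : Matrix (Fin N × Fin n) (Fin N × Fin n) ℝ :=
  S.b k • (S.lap k ω ⊗ₖ (1 : Matrix (Fin n) (Fin n) ℝ)) + S.a k • S.gram k ω

/-- Noise of the error recursion. -/
noncomputable def noiseTerm (k : ℕ) (ω : Ω) : EuclideanSpace ℝ (Fin N × Fin n) :=
  WithLp.toLp 2 fun ip => S.a k * ∑ r, S.H ip.1 k ω r ip.2 * S.v ip.1 k ω r
    + S.b k * ∑ j, S.adj k ω ip.1 j *
      (S.f j ip.1 (S.est k ω j - S.est k ω ip.1) * S.ξ j ip.1 k ω ip.2)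

lemma gram_apply (k : ℕ) (ω : Ω) (i j : Fin N) (p q : Fin n) :
    S.gram k ω (i, p) (j, q) = if i = j then ∑ r, S.H i k ω r p * S.H i k ω r q else 0 := by
  have hb : ∀ l r i p, S.bigH k ω ⟨l, r⟩ (i, p)
      = Matrix.blockDiagonal' (fun i => S.H i k ω) ⟨l, r⟩ ⟨i, p⟩ := fun _ _ _ _ => rfl
  rw [gram, Matrix.mul_apply, Fintype.sum_sigma, Finset.sum_eq_single i]
  · simp only [Matrix.transpose_apply, hb, Matrix.blockDiagonal'_apply_eq]
    split_ifs with h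
    · subst h
      simp only [Matrix.blockDiagonal'_apply_eq]
    · exact Finset.sum_eq_zero fun r _ => by
        rw [Matrix.blockDiagonal'_apply_ne _ _ _ h, mul_zero]
  · intro l _ hl
    exact Finset.sum_eq_zero fun r _ => by
      rw [Matrix.transpose_apply, hb, Matrix.blockDiagonal'_apply_ne _ _ _ hl, zero_mul]
  · simp

lemma gram_mulVec (k : ℕ) (ω : Ω) (x : Fin N × Fin n → ℝ) (i : Fin N) (p : Fin n) :
    (S.gram k ω *ᵥ x) (i, p) = ∑ r, S.H i k ω r p * ∑ q, S.H i k ω r q * x (i, q) := by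
  simp only [Matrix.mulVec, dotProduct, Fintype.sum_prod_type, gram_apply, ite_mul, zero_mul]
  rw [Finset.sum_comm]
  simp only [Finset.sum_ite_eq, Finset.mem_univ, if_true, Finset.sum_mul, Finset.mul_sum]
  rw [Finset.sum_comm]
  exact Finset.sum_congr rfl fun _ _ => Finset.sum_congr rfl fun _ _ => by ring

lemma kronecker_one_mulVec (A : Matrix (Fin N) (Fin N) ℝ) (x : Fin N × Fin n → ℝ) (i : Fin N)
    (p : Fin n) :
    ((A ⊗ₖ (1 : Matrix (Fin n) (Fin n) ℝ)) *ᵥ x) (i, p) = ∑ j, A i j * x (j, p) := by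
  simp [Matrix.mulVec, dotProduct, Fintype.sum_prod_type, Matrix.kroneckerMap_apply,
    Matrix.one_apply]

/-- Weights vanish off the random neighbourhood, so the sum may run over all nodes. -/
lemma est_succ_apply (k : ℕ) (ω : Ω) (i : Fin N) (p : Fin n) :
    S.est (k + 1) ω i p = S.est k ω i p
      + S.a k * ∑ r, S.H i k ω r p * (∑ q, S.H i k ω r q * S.x₀ q + S.v i k ω r
        - ∑ q, S.H i k ω r q * S.est k ω i q)
      + S.b k * ∑ j, S.adj k ω i j * (S.est k ω j p
        + S.f j i (S.est k ω j - S.est k ω i) * S.ξ j i k ω p - S.est k ω i p)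
      - S.lam k * S.est k ω i p := by
  have h1 : ∑ j ∈ S.nbrs k ω i, S.adj k ω i j • (S.received (S.est k ω) j i k ω - S.est k ω i)
      = ∑ j, S.adj k ω i j • (S.received (S.est k ω) j i k ω - S.est k ω i) := by
    refine Finset.sum_filter_of_ne fun j _ h h0 => h ?_
    rw [h0, zero_smul]
  rw [est, h1]
  simp [obs, received, Matrix.mulVec, dotProduct, Matrix.toLpLin_apply]

lemma err_succ (k : ℕ) (ω : Ω) : S.err (k + 1) ω = S.err k ω
    - Matrix.toEuclideanCLM (n := Fin N × Fin n) (𝕜 := ℝ) (S.driftMat k ω) (S.err k ω)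
    + S.noiseTerm k ω - S.lam k • (S.err k ω + S.stackedParam) := by
  ext ⟨i, p⟩
  have hd : (Matrix.toEuclideanCLM (n := Fin N × Fin n) (𝕜 := ℝ) (S.driftMat k ω) (S.err k ω))
      (i, p) = S.b k * ∑ j, S.lap k ω i j * S.err k ω (j, p)
        + S.a k * ∑ r, S.H i k ω r p * ∑ q, S.H i k ω r q * S.err k ω (i, q) := by
    rw [Matrix.ofLp_toEuclideanCLM, driftMat, Matrix.add_mulVec, Matrix.smul_mulVec,
      Matrix.smul_mulVec, Pi.add_apply, Pi.smul_apply, Pi.smul_apply, gram_mulVec,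
      kronecker_one_mulVec]
    rfl
  -- The zero row sums of the Laplacian cancel the common vector `x₀`, leaving differences of
  -- estimates.
  have hl : ∑ j, S.lap k ω i j * S.err k ω (j, p)
      = - ∑ j, S.adj k ω i j * (S.est k ω j p - S.est k ω i p) := by
    simp only [lap, Matrix.sub_apply, Matrix.diagonal_apply, sub_mul, ite_mul, zero_mul,
      Finset.sum_sub_distrib, Finset.sum_ite_eq, Finset.mem_univ, if_true, err, mul_sub,
      ← Finset.sum_mul]
    ring
  simp only [PiLp.add_apply, PiLp.sub_apply, PiLp.smul_apply, smul_eq_mul, hd, hl]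
  simp only [err, stackedParam, noiseTerm, est_succ_apply]
  have h1 : ∀ r, S.H i k ω r p * (∑ q, S.H i k ω r q * S.x₀ q + S.v i k ω r
        - ∑ q, S.H i k ω r q * S.est k ω i q)
      = S.H i k ω r p * S.v i k ω r
        - S.H i k ω r p * ∑ q, S.H i k ω r q * (S.est k ω i q - S.x₀ q) := fun r => by
    simp only [mul_sub, Finset.sum_sub_distrib]; ring
  have h2 : ∀ j, S.adj k ω i j * (S.est k ω j p
        + S.f j i (S.est k ω j - S.est k ω i) * S.ξ j i k ω p - S.est k ω i p)
      = S.adj k ω i j * (S.est k ω j p - S.est k ω i p)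
        + S.adj k ω i j * (S.f j i (S.est k ω j - S.est k ω i) * S.ξ j i k ω p) :=
    fun j => by ring
  simp only [h1, h2, Finset.sum_sub_distrib, Finset.sum_add_distrib]
  ring

/-! ### Measurability and the filtration of past data. -/

section Measurability

/-- The σ-algebra is left arbitrary so that the same statement, used with `past (k + 1)`, gives
adaptedness. -/
lemma measurable_est_succ [MeasurableSpace Ω] {k : ℕ}
    (hadj : ∀ i j, Measurable fun ω => S.adj k ω i j)
    (hH : ∀ i p q, Measurable fun ω => S.H i k ω p q) (hv : ∀ i, Measurable (S.v i k))
    (hξ : ∀ j i, Measurable (S.ξ j i k)) (hf : ∀ j i, Measurable (S.f j i))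
    (hest : ∀ i, Measurable fun ω => S.est k ω i) (i : Fin N) :
    Measurable fun ω => S.est (k + 1) ω i := by
  have hc : ∀ j p, Measurable fun ω => S.est k ω j p := fun j p => by
    have := hest j; fun_prop
  have hvc : ∀ j r, Measurable fun ω => S.v j k ω r := fun j r => by
    have := hv j; fun_prop
  have hξc : ∀ j r, Measurable fun ω => S.ξ j i k ω r := fun j r => by
    have := hξ j i; fun_prop
  have hfc : ∀ j, Measurable fun ω => S.f j i (S.est k ω j - S.est k ω i) := fun j =>
    (hf j i).comp ((hest j).sub (hest i))
  have : Measurable fun ω => WithLp.toLp 2 fun p => S.est (k + 1) ω i p := by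
    refine (WithLp.measurable_toLp 2 (Fin n → ℝ)).comp (measurable_pi_iff.2 fun p => ?_)
    simp only [est_succ_apply]
    fun_prop
  exact this

lemma sigmaGH_le [mΩ : MeasurableSpace Ω] {s : ℕ}
    (hadj : ∀ i j, Measurable fun ω => S.adj s ω i j)
    (hH : ∀ i p q, Measurable fun ω => S.H i s ω p q) : S.sigmaGH s ≤ mΩ := by
  refine sup_le (iSup_le fun i => iSup_le fun j => ?_)
    (iSup_le fun i => iSup_le fun p => iSup_le fun q => ?_)
  · rw [← BorelSpace.measurable_eq]; exact (hadj i j).comap_le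
  · rw [← BorelSpace.measurable_eq]; exact (hH i p q).comap_le

lemma sigmaNoise_le [mΩ : MeasurableSpace Ω] {s : ℕ} (hv : ∀ i, Measurable (S.v i s))
    (hξ : ∀ j i, Measurable (S.ξ j i s)) : S.sigmaNoise s ≤ mΩ := by
  refine sup_le (iSup_le fun i => ?_) (iSup_le fun j => iSup_le fun i => ?_)
  · rw [← BorelSpace.measurable_eq]; exact (hv i).comap_le
  · rw [← BorelSpace.measurable_eq]; exact (hξ j i).comap_le

lemma measurable_adj_sigmaGH (s : ℕ) (i j : Fin N) :
    Measurable[S.sigmaGH s] fun ω => S.adj s ω i j := by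
  rw [measurable_iff_comap_le, BorelSpace.measurable_eq (α := ℝ)]
  exact le_sup_of_le_left (le_iSup₂_of_le i j le_rfl)

lemma measurable_H_sigmaGH (s : ℕ) (i : Fin N) (p : Fin (m i)) (q : Fin n) :
    Measurable[S.sigmaGH s] fun ω => S.H i s ω p q := by
  rw [measurable_iff_comap_le, BorelSpace.measurable_eq (α := ℝ)]
  exact le_sup_of_le_right (le_iSup_of_le i (le_iSup₂_of_le p q le_rfl))

lemma measurable_v_sigmaNoise (s : ℕ) (i : Fin N) : Measurable[S.sigmaNoise s] (S.v i s) := by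
  rw [measurable_iff_comap_le, BorelSpace.measurable_eq (α := EuclideanSpace ℝ (Fin (m i)))]
  exact le_sup_of_le_left (le_iSup_of_le i le_rfl)

lemma measurable_ξ_sigmaNoise (s : ℕ) (j i : Fin N) :
    Measurable[S.sigmaNoise s] (S.ξ j i s) := by
  rw [measurable_iff_comap_le, BorelSpace.measurable_eq (α := EuclideanSpace ℝ (Fin n))]
  exact le_sup_of_le_right (le_iSup₂_of_le j i le_rfl)

lemma past_mono : Monotone S.past := fun _ _ hkl =>
  iSup₂_le fun s hs => le_iSup₂_of_le s (hs.trans_le hkl) le_rfl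

lemma sigmaGH_sup_le_past {s k : ℕ} (h : s < k) : S.sigmaGH s ⊔ S.sigmaNoise s ≤ S.past k :=
  le_iSup₂_of_le (f := fun s (_ : s < k) => S.sigmaGH s ⊔ S.sigmaNoise s) s h le_rfl

lemma measurable_est_past (hf : ∀ j i, Measurable (S.f j i)) (k : ℕ) (i : Fin N) :
    Measurable[S.past k] fun ω => S.est k ω i := by
  induction k generalizing i with
  | zero => exact @measurable_const _ _ _ (S.past 0) _
  | succ k ih =>
    have hGH : S.sigmaGH k ≤ S.past (k + 1) :=
      le_sup_left.trans (S.sigmaGH_sup_le_past (Nat.lt_succ_self k))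
    have hN : S.sigmaNoise k ≤ S.past (k + 1) :=
      le_sup_right.trans (S.sigmaGH_sup_le_past (Nat.lt_succ_self k))
    exact @measurable_est_succ Ω N n m S (S.past (k + 1)) k
      (fun i j => (S.measurable_adj_sigmaGH k i j).mono hGH le_rfl)
      (fun i p q => (S.measurable_H_sigmaGH k i p q).mono hGH le_rfl)
      (fun i => (S.measurable_v_sigmaNoise k i).mono hN le_rfl)
      (fun j i => (S.measurable_ξ_sigmaNoise k j i).mono hN le_rfl) hf
      (fun i => (ih i).mono (S.past_mono (Nat.le_succ k)) le_rfl) i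

lemma measurable_err [MeasurableSpace Ω] {k : ℕ}
    (hest : ∀ i, Measurable fun ω => S.est k ω i) : Measurable (S.err k) := by
  refine (WithLp.measurable_toLp 2 (Fin N × Fin n → ℝ)).comp (measurable_pi_iff.2 fun ip => ?_)
  have := hest ip.1
  fun_prop

lemma measurable_err_past (hf : ∀ j i, Measurable (S.f j i)) (k : ℕ) :
    Measurable[S.past k] (S.err k) :=
  @measurable_err Ω N n m S (S.past k) k fun i => S.measurable_est_past hf k i

lemma measurable_lap [MeasurableSpace Ω] {k : ℕ}
    (hadj : ∀ i j, Measurable fun ω => S.adj k ω i j) (i j : Fin N) :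
    Measurable fun ω => S.lap k ω i j := by
  simp only [lap, Matrix.sub_apply, Matrix.diagonal_apply]
  split_ifs <;> fun_prop

lemma measurable_gram [MeasurableSpace Ω] {k : ℕ}
    (hH : ∀ i p q, Measurable fun ω => S.H i k ω p q) (x y : Fin N × Fin n) :
    Measurable fun ω => S.gram k ω x y := by
  obtain ⟨i, p⟩ := x
  obtain ⟨j, q⟩ := y
  simp only [gram_apply]
  split_ifs <;> fun_prop

lemma measurable_driftMat [MeasurableSpace Ω] {k : ℕ}
    (hadj : ∀ i j, Measurable fun ω => S.adj k ω i j)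
    (hH : ∀ i p q, Measurable fun ω => S.H i k ω p q) (x y : Fin N × Fin n) :
    Measurable fun ω => S.driftMat k ω x y := by
  have h1 := S.measurable_lap hadj x.1 y.1
  have h2 := S.measurable_gram hH x y
  simp only [driftMat, Matrix.add_apply, Matrix.smul_apply, Matrix.kroneckerMap_apply]
  fun_prop

lemma measurable_noiseTerm [MeasurableSpace Ω] {k : ℕ}
    (hadj : ∀ i j, Measurable fun ω => S.adj k ω i j)
    (hH : ∀ i p q, Measurable fun ω => S.H i k ω p q) (hv : ∀ i, Measurable (S.v i k))
    (hξ : ∀ j i, Measurable (S.ξ j i k)) (hf : ∀ j i, Measurable (S.f j i))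
    (hest : ∀ i, Measurable fun ω => S.est k ω i) : Measurable (S.noiseTerm k) := by
  have hfc : ∀ j i, Measurable fun ω => S.f j i (S.est k ω j - S.est k ω i) := fun j i =>
    (hf j i).comp ((hest j).sub (hest i))
  refine (WithLp.measurable_toLp 2 (Fin N × Fin n → ℝ)).comp (measurable_pi_iff.2 fun ip => ?_)
  have hvc : ∀ r, Measurable fun ω => S.v ip.1 k ω r := fun r => by
    have := hv ip.1; fun_prop
  have hξc : ∀ j, Measurable fun ω => S.ξ j ip.1 k ω ip.2 := fun j => by
    have := hξ j ip.1; fun_prop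
  fun_prop

lemma measurable_noiseSq [MeasurableSpace Ω] {k : ℕ} (hv : ∀ i, Measurable (S.v i k))
    (hξ : ∀ j i, Measurable (S.ξ j i k)) : Measurable (S.noiseSq k) := by
  unfold noiseSq
  fun_prop

variable [mΩ : MeasurableSpace Ω]

lemma past_le (hmeas : S.IsMeasurable) (k : ℕ) : S.past k ≤ mΩ :=
  iSup₂_le fun s _ => sup_le (S.sigmaGH_le (hmeas.adj s) fun i => hmeas.H i s)
    (S.sigmaNoise_le (fun i => hmeas.v i s) fun j i => hmeas.ξ j i s)

/-- The filtration of all data. -/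
def pastFiltration (hmeas : S.IsMeasurable) : Filtration ℕ mΩ :=
  ⟨S.past, S.past_mono, S.past_le hmeas⟩

end Measurability

end Model

namespace Model

variable {Ω : Type*} {N n : ℕ} {m : Fin N → ℕ} (S : Model Ω N n m)

/-! ### Pathwise bounds on drift and noise. -/

section Pathwise

/-- Off the diagonal the entries of the Laplacian are the negated weights; on it the weights are
zero. -/
lemma abs_adj_le_specNorm_lap (k : ℕ) (ω : Ω) (i j : Fin N) :
    |S.adj k ω i j| ≤ specNorm (S.lap k ω) := by
  by_cases h : i = j
  · subst h
    rw [S.adj_diag, abs_zero]; exact specNorm_nonneg _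
  · have := abs_entry_le_specNorm (S.lap k ω) i j
    simpa [lap, Matrix.diagonal_apply_ne _ h] using this

/-- A crude dimension-dependent constant suffices: expand in matrix units and bound each entry by
the norm of `A`. -/
lemma specNorm_kronecker_one_le (A : Matrix (Fin N) (Fin N) ℝ) :
    specNorm (A ⊗ₖ (1 : Matrix (Fin n) (Fin n) ℝ)) ≤ specNorm A *
      ∑ x : Fin N × Fin n, ∑ y : Fin N × Fin n, specNorm (Matrix.single x y (1 : ℝ)) := by
  refine (specNorm_le_sum _).trans ?_
  simp only [Finset.mul_sum]
  refine Finset.sum_le_sum fun x _ => Finset.sum_le_sum fun y _ =>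
    mul_le_mul_of_nonneg_right ?_ (specNorm_nonneg _)
  rw [Matrix.kroneckerMap_apply, Matrix.one_apply]
  split_ifs
  · rw [mul_one]; exact abs_entry_le_specNorm _ _ _
  · rw [mul_zero, abs_zero]; exact specNorm_nonneg _

lemma specNorm_driftMat_le (k : ℕ) (ω : Ω) (ha : 0 ≤ S.a k) (hb : 0 ≤ S.b k) :
    specNorm (S.driftMat k ω) ≤ S.b k * (specNorm (S.lap k ω) *
      ∑ x : Fin N × Fin n, ∑ y : Fin N × Fin n, specNorm (Matrix.single x y (1 : ℝ)))
      + S.a k * specNorm (S.gram k ω) := by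
  have h : specNorm (S.driftMat k ω) ≤ S.b k * specNorm (S.lap k ω ⊗ₖ (1 : Matrix (Fin n) (Fin n) ℝ))
      + S.a k * specNorm (S.gram k ω) := by
    unfold specNorm driftMat
    rw [map_add, map_smul, map_smul]
    refine (norm_add_le _ _).trans ?_
    rw [norm_smul, norm_smul, Real.norm_of_nonneg ha, Real.norm_of_nonneg hb]
  exact h.trans (add_le_add_left
    (mul_le_mul_of_nonneg_left (specNorm_kronecker_one_le _) hb) _)

lemma sq_err_apply_le (k : ℕ) (ω : Ω) (x : Fin N × Fin n) :
    S.err k ω x ^ 2 ≤ ‖S.err k ω‖ ^ 2 := by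
  rw [EuclideanSpace.real_norm_sq_eq]
  exact Finset.single_le_sum (f := fun x => S.err k ω x ^ 2) (fun _ _ => sq_nonneg _)
    (Finset.mem_univ x)

lemma norm_est_sub_le (k : ℕ) (ω : Ω) (i : Fin N) :
    ‖S.est k ω i - S.x₀‖ ≤ ‖S.err k ω‖ := by
  rw [← abs_of_nonneg (norm_nonneg (S.est k ω i - S.x₀)), ← abs_of_nonneg (norm_nonneg (S.err k ω)),
    ← sq_le_sq, EuclideanSpace.real_norm_sq_eq, EuclideanSpace.real_norm_sq_eq,
    Fintype.sum_prod_type]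
  exact Finset.single_le_sum (f := fun i => ∑ p, S.err k ω (i, p) ^ 2)
    (fun _ _ => Finset.sum_nonneg fun _ _ => sq_nonneg _) (Finset.mem_univ i)

/-- Two estimates differ by at most `2 * ‖err‖`, and `(σ d + b₀)² ≤ 2 σ² d² + 2 b₀²`; this gives the
coefficients 8 and 2. -/
lemma sq_intensity_le {σ b₀ : ℝ} (hσ : ∀ j i x, |S.f j i x| ≤ σ * ‖x‖ + b₀) (k : ℕ) (ω : Ω)
    (j i : Fin N) : S.f j i (S.est k ω j - S.est k ω i) ^ 2
      ≤ (8 * σ ^ 2 + 2 * b₀ ^ 2) * (1 + ‖S.err k ω‖ ^ 2) := by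
  have h1 : ‖S.est k ω j - S.est k ω i‖ ≤ 2 * ‖S.err k ω‖ := by
    have := norm_sub_le (S.est k ω j - S.x₀) (S.est k ω i - S.x₀)
    rw [sub_sub_sub_cancel_right] at this
    linarith [S.norm_est_sub_le k ω j, S.norm_est_sub_le k ω i]
  set d := ‖S.est k ω j - S.est k ω i‖
  have h2 : S.f j i (S.est k ω j - S.est k ω i) ^ 2 ≤ (σ * d + b₀) ^ 2 := by
    rw [← sq_abs]; exact pow_le_pow_left₀ (abs_nonneg _) (hσ j i _) 2
  have h3 : d ^ 2 ≤ 4 * ‖S.err k ω‖ ^ 2 := by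
    have := pow_le_pow_left₀ (norm_nonneg _) h1 2
    linarith
  have h4 := mul_le_mul_of_nonneg_left h3 (sq_nonneg σ)
  have h5 := mul_nonneg (sq_nonneg b₀) (sq_nonneg ‖S.err k ω‖)
  linarith [sq_nonneg (σ * d - b₀), sq_nonneg σ]

lemma sq_v_le_noiseSq (k : ℕ) (ω : Ω) (i : Fin N) : ‖S.v i k ω‖ ^ 2 ≤ S.noiseSq k ω :=
  le_add_of_le_of_nonneg (Finset.single_le_sum (f := fun i => ‖S.v i k ω‖ ^ 2)
    (fun _ _ => sq_nonneg _) (Finset.mem_univ i))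
    (Finset.sum_nonneg fun _ _ => Finset.sum_nonneg fun _ _ => sq_nonneg _)

lemma sum_sq_ξ_le_noiseSq (k : ℕ) (ω : Ω) (i : Fin N) :
    ∑ j, ‖S.ξ j i k ω‖ ^ 2 ≤ S.noiseSq k ω := by
  refine le_add_of_nonneg_of_le (Finset.sum_nonneg fun _ _ => sq_nonneg _) ?_
  rw [Finset.sum_comm]
  exact Finset.single_le_sum (f := fun i => ∑ j, ‖S.ξ j i k ω‖ ^ 2)
    (fun _ _ => Finset.sum_nonneg fun _ _ => sq_nonneg _) (Finset.mem_univ i)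

lemma noiseSq_nonneg (k : ℕ) (ω : Ω) : 0 ≤ S.noiseSq k ω :=
  add_nonneg (Finset.sum_nonneg fun _ _ => sq_nonneg _)
    (Finset.sum_nonneg fun _ _ => Finset.sum_nonneg fun _ _ => sq_nonneg _)

lemma sum_sq_H_le (k : ℕ) (ω : Ω) (i : Fin N) (p : Fin n) :
    ∑ r, S.H i k ω r p ^ 2 ≤ specNorm (S.gram k ω) := by
  have h := (le_abs_self _).trans (abs_entry_le_specNorm (S.gram k ω) (i, p) (i, p))
  rw [gram_apply, if_pos rfl] at h
  simpa [sq] using h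

lemma sq_apply_le_sq_norm {ι : Type*} [Fintype ι] (x : EuclideanSpace ℝ ι) (i : ι) :
    x i ^ 2 ≤ ‖x‖ ^ 2 := by
  rw [EuclideanSpace.real_norm_sq_eq]
  exact Finset.single_le_sum (f := fun i => x i ^ 2) (fun _ _ => sq_nonneg _) (Finset.mem_univ i)

/-- By Cauchy–Schwarz, `noiseSq` is separated from factors known given `pastNoiseAndDesign`, so that
its conditional bound can be applied to each product. -/
lemma norm_noiseTerm_sq_le {σ b₀ ρ : ℝ} (hσ : ∀ j i x, |S.f j i x| ≤ σ * ‖x‖ + b₀) (k : ℕ)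
    (ω : Ω) (ha : 0 ≤ S.a k) (hb : 0 ≤ S.b k) (hρ : specNorm (S.lap k ω) ≤ ρ) :
    ‖S.noiseTerm k ω‖ ^ 2 ≤ (S.a k + S.b k) ^ 2 *
      (2 * (N * n) * (specNorm (S.gram k ω) * S.noiseSq k ω)
        + 2 * (N * n) * (N * (ρ ^ 2 * (8 * σ ^ 2 + 2 * b₀ ^ 2)))
          * ((1 + ‖S.err k ω‖ ^ 2) * S.noiseSq k ω)) := by
  set z := S.noiseSq k ω
  have hz : 0 ≤ z := S.noiseSq_nonneg k ω
  set g := specNorm (S.gram k ω)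
  have hg : 0 ≤ g := specNorm_nonneg _
  set w := 1 + ‖S.err k ω‖ ^ 2
  have hw : 0 ≤ w := by positivity
  set κ := 8 * σ ^ 2 + 2 * b₀ ^ 2
  have hκ : 0 ≤ κ := by positivity
  have hentry : ∀ x : Fin N × Fin n, S.noiseTerm k ω x ^ 2 ≤
      (S.a k + S.b k) ^ 2 * (2 * (g * z) + 2 * (N * (ρ ^ 2 * κ)) * (w * z)) := by
    rintro ⟨i, p⟩
    have e1 : (∑ r, S.H i k ω r p * S.v i k ω r) ^ 2 ≤ g * z := by
      refine (Finset.sum_mul_sq_le_sq_mul_sq _ _ _).trans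
        (mul_le_mul (S.sum_sq_H_le k ω i p) ?_ (Finset.sum_nonneg fun _ _ => sq_nonneg _) hg)
      rw [← EuclideanSpace.real_norm_sq_eq]
      exact S.sq_v_le_noiseSq k ω i
    have e2 : (∑ j, S.adj k ω i j * (S.f j i (S.est k ω j - S.est k ω i) * S.ξ j i k ω p)) ^ 2
        ≤ N * (ρ ^ 2 * κ) * (w * z) := by
      simp only [← mul_assoc (S.adj k ω i _)]
      refine (Finset.sum_mul_sq_le_sq_mul_sq _ _ _).trans ?_
      have f1 : ∑ j, (S.adj k ω i j * S.f j i (S.est k ω j - S.est k ω i)) ^ 2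
          ≤ N * (ρ ^ 2 * (κ * w)) := by
        refine (Finset.sum_le_card_nsmul _ _ (ρ ^ 2 * (κ * w)) fun j _ => ?_).trans (by simp)
        rw [mul_pow]
        refine mul_le_mul ?_ (S.sq_intensity_le hσ k ω j i) (sq_nonneg _) (sq_nonneg _)
        rw [← sq_abs]
        exact pow_le_pow_left₀ (abs_nonneg _) ((S.abs_adj_le_specNorm_lap k ω i j).trans hρ) 2
      have f2 : ∑ j, S.ξ j i k ω p ^ 2 ≤ z :=
        (Finset.sum_le_sum fun j _ => sq_apply_le_sq_norm _ p).trans (S.sum_sq_ξ_le_noiseSq k ω i)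
      calc _ ≤ N * (ρ ^ 2 * (κ * w)) * z :=
            mul_le_mul f1 f2 (Finset.sum_nonneg fun _ _ => sq_nonneg _) (by positivity)
        _ = _ := by ring
    change (S.a k * _ + S.b k * _) ^ 2 ≤ _
    have a1 : S.a k ^ 2 ≤ (S.a k + S.b k) ^ 2 := pow_le_pow_left₀ ha (by linarith) 2
    have b1 : S.b k ^ 2 ≤ (S.a k + S.b k) ^ 2 := pow_le_pow_left₀ hb (by linarith) 2
    have g1 := mul_le_mul a1 e1 (sq_nonneg _) (sq_nonneg _)
    have g2 := mul_le_mul b1 e2 (sq_nonneg _) (sq_nonneg _)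
    refine (add_sq_le).trans ?_
    rw [mul_pow, mul_pow]
    linarith
  rw [EuclideanSpace.real_norm_sq_eq]
  refine (Finset.sum_le_card_nsmul _ _ _ fun x _ => hentry x).trans_eq ?_
  simp only [Finset.card_univ, Fintype.card_prod, Fintype.card_fin, nsmul_eq_mul, Nat.cast_mul]
  ring

lemma inner_noiseTerm (k : ℕ) (ω : Ω) : inner ℝ (S.err k ω) (S.noiseTerm k ω)
    = ∑ i, ∑ p, (∑ r, S.a k * S.err k ω (i, p) * S.H i k ω r p * S.v i k ω r
      + ∑ j, S.b k * S.err k ω (i, p) * S.adj k ω i j *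
        S.f j i (S.est k ω j - S.est k ω i) * S.ξ j i k ω p) := by
  rw [PiLp.inner_apply, Fintype.sum_prod_type]
  refine Finset.sum_congr rfl fun i _ => Finset.sum_congr rfl fun p _ => ?_
  simp only [noiseTerm, RCLike.inner_apply, conj_trivial, Finset.mul_sum, Finset.sum_mul, add_mul]
  congr 1
  · exact Finset.sum_congr rfl fun r _ => by ring
  · exact Finset.sum_congr rfl fun r _ => by ring

end Pathwise

/-! ### Enlarging the conditioning by the whole design. -/

section Conditioning

/-- The noises before time `k`. -/
abbrev pastNoise (k : ℕ) : MeasurableSpace Ω := ⨆ (s : ℕ) (_ : s < k), S.sigmaNoise s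

/-- The noises before time `k` and all graphs and regression matrices. -/
abbrev pastNoiseAndDesign (k : ℕ) : MeasurableSpace Ω := S.pastNoise k ⊔ ⨆ s, S.sigmaGH s

lemma past_le_pastNoiseAndDesign (k : ℕ) : S.past k ≤ S.pastNoiseAndDesign k :=
  iSup₂_le fun t ht => sup_le ((le_iSup S.sigmaGH t).trans le_sup_right)
    ((le_iSup₂_of_le (f := fun s (_ : s < k) => S.sigmaNoise s) t ht le_rfl).trans le_sup_left)

lemma sigmaGH_le_pastNoiseAndDesign (k : ℕ) : S.sigmaGH k ≤ S.pastNoiseAndDesign k :=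
  (le_iSup S.sigmaGH k).trans le_sup_right

variable [mΩ : MeasurableSpace Ω]

lemma pastNoiseAndDesign_le (hmeas : S.IsMeasurable) (k : ℕ) : S.pastNoiseAndDesign k ≤ mΩ :=
  sup_le (iSup₂_le fun s _ => S.sigmaNoise_le (fun i => hmeas.v i s) fun j i => hmeas.ξ j i s)
    (iSup_le fun s => S.sigmaGH_le (hmeas.adj s) fun i => hmeas.H i s)

variable {μ : Measure Ω} [IsProbabilityMeasure μ]

/-- `past k` lies between the past noises and the past noises joined with the design, which is
independent of all noises; so the added information is irrelevant to the current noise, while `H`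
and `adj` at time `k` become known. -/
lemma condExp_pastNoiseAndDesign (hmeas : S.IsMeasurable) (hA2 : S.NoiseCondition μ) (k : ℕ)
    {X : Ω → ℝ} (hX : StronglyMeasurable[S.sigmaNoise k] X) (hXi : Integrable X μ) :
    μ[X | S.pastNoiseAndDesign k] =ᵐ[μ] μ[X | S.past k] :=
  condExp_sup_eq_condExp_of_indep
    (iSup_le fun s => S.sigmaNoise_le (fun i => hmeas.v i s) fun j i => hmeas.ξ j i s)
    (iSup₂_le fun s _ => le_iSup (fun t => S.sigmaNoise t) s)
    (iSup_le fun s => S.sigmaGH_le (hmeas.adj s) fun i => hmeas.H i s)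
    hA2.indep
    (iSup₂_le fun _ hs => le_sup_right.trans (S.sigmaGH_sup_le_past hs))
    (S.past_le_pastNoiseAndDesign k)
    (hX.mono (le_iSup S.sigmaNoise k)) hXi

omit [IsProbabilityMeasure μ] in
lemma condExp_apply_eq_zero {ι : Type*} [Fintype ι] {F : MeasurableSpace Ω}
    {X : Ω → EuclideanSpace ℝ ι} (hXi : Integrable X μ) (h : μ[X | F] =ᵐ[μ] 0) (r : ι) :
    μ[fun ω => X ω r | F] =ᵐ[μ] 0 := by
  have h1 := (EuclideanSpace.proj (𝕜 := ℝ) r).comp_condExp_comm (m := F) hXi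
  refine EventuallyEq.trans (h1.symm : μ[fun ω => X ω r | F] =ᵐ[μ] _) ?_
  filter_upwards [h] with ω hω
  simp [hω]

lemma condExp_v_apply (hmeas : S.IsMeasurable) (hA2 : S.NoiseCondition μ) (k : ℕ) (i : Fin N)
    (r : Fin (m i)) :
    μ[fun ω => S.v i k ω r | S.pastNoiseAndDesign k] =ᵐ[μ] 0 :=
  (S.condExp_pastNoiseAndDesign hmeas hA2 k
    (Measurable.stronglyMeasurable
      ((EuclideanSpace.proj (𝕜 := ℝ) r).measurable.comp (S.measurable_v_sigmaNoise k i)))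
    ((EuclideanSpace.proj (𝕜 := ℝ) r).integrable_comp (hA2.integrable_v i k))).trans
    (condExp_apply_eq_zero (hA2.integrable_v i k) (hA2.condExp_v i k) r)

lemma condExp_ξ_apply (hmeas : S.IsMeasurable) (hA2 : S.NoiseCondition μ) (k : ℕ) (j i : Fin N)
    (p : Fin n) :
    μ[fun ω => S.ξ j i k ω p | S.pastNoiseAndDesign k] =ᵐ[μ] 0 :=
  (S.condExp_pastNoiseAndDesign hmeas hA2 k
    (Measurable.stronglyMeasurable
      ((EuclideanSpace.proj (𝕜 := ℝ) p).measurable.comp (S.measurable_ξ_sigmaNoise k j i)))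
    ((EuclideanSpace.proj (𝕜 := ℝ) p).integrable_comp (hA2.integrable_ξ j i k))).trans
    (condExp_apply_eq_zero (hA2.integrable_ξ j i k) (hA2.condExp_ξ j i k) p)

lemma condExp_noiseSq (hmeas : S.IsMeasurable) (hA2 : S.NoiseCondition μ) (k : ℕ) :
    μ[S.noiseSq k | S.pastNoiseAndDesign k] =ᵐ[μ] μ[S.noiseSq k | S.past k] := by
  have h : Measurable[S.sigmaNoise k] (S.noiseSq k) :=
    @measurable_noiseSq Ω N n m S (S.sigmaNoise k) k
      (S.measurable_v_sigmaNoise k) (S.measurable_ξ_sigmaNoise k)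
  exact S.condExp_pastNoiseAndDesign hmeas hA2 k h.stronglyMeasurable (hA2.integrable_sq k)

omit [IsProbabilityMeasure μ] in
-- Both summands are nonnegative, so each is at most `ρ₀`; nonnegativity of the conditional moment
-- also allows the root to be undone.
lemma condExp_gramPow_le {h : ℕ} {ρ₀ : ℝ}
    (h_bdd : ∀ᵐ ω ∂μ, ∀ k, specNorm (S.lap k ω)
      + ((μ[S.gramPow h k | S.past k]) ω) ^ ((1 : ℝ) / 2 ^ max h 2) ≤ ρ₀) :
    ∀ᵐ ω ∂μ, ∀ k, specNorm (S.lap k ω) ≤ ρ₀ ∧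
      (μ[S.gramPow h k | S.past k]) ω ≤ ρ₀ ^ 2 ^ max h 2 := by
  have hnn : ∀ᵐ ω ∂μ, ∀ k, 0 ≤ (μ[S.gramPow h k | S.past k]) ω := ae_all_iff.2 fun k =>
    condExp_nonneg (ae_of_all _ fun ω => pow_nonneg (specNorm_nonneg _) _)
  filter_upwards [h_bdd, hnn] with ω h1 h2 k
  have h3 := Real.rpow_nonneg (h2 k) ((1 : ℝ) / 2 ^ max h 2)
  have h4 := specNorm_nonneg (S.lap k ω)
  refine ⟨by linarith [h1 k], ?_⟩
  have h5 := Real.rpow_inv_natCast_pow (h2 k) (n := 2 ^ max h 2) (by positivity)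
  rw [← h5]
  refine pow_le_pow_left₀ (Real.rpow_nonneg (h2 k) _) ?_ _
  have h6 : (((2 ^ max h 2 : ℕ) : ℝ))⁻¹ = (1 : ℝ) / 2 ^ max h 2 := by push_cast; rw [one_div]
  rw [h6]
  linarith [h1 k]

end Conditioning

end Model

/-! ### The algorithm as an instance of the abstract recursion. -/

namespace Model

variable {Ω : Type*} {N n : ℕ} {m : Fin N → ℕ} (S : Model Ω N n m)

/-- Random factor in the bound of the drift matrix by the gains. -/
noncomputable def driftScale (ρ : ℝ) (k : ℕ) (ω : Ω) : ℝ :=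
  1 + ρ * ∑ x : Fin N × Fin n, ∑ y : Fin N × Fin n, specNorm (Matrix.single x y (1 : ℝ))
    + specNorm (S.gram k ω)

lemma sum_specNorm_single_nonneg :
    0 ≤ ∑ x : Fin N × Fin n, ∑ y : Fin N × Fin n, specNorm (Matrix.single x y (1 : ℝ)) :=
  Finset.sum_nonneg fun _ _ => Finset.sum_nonneg fun _ _ => specNorm_nonneg _

lemma specNorm_gram_add_one_le_driftScale {ρ : ℝ} (hρ : 0 ≤ ρ) (k : ℕ) (ω : Ω) :
    1 + specNorm (S.gram k ω) ≤ S.driftScale ρ k ω := by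
  have := mul_nonneg hρ (sum_specNorm_single_nonneg (N := N) (n := n))
  unfold driftScale
  linarith

lemma specNorm_driftMat_le_driftScale {ρ : ℝ} (hρ : 0 ≤ ρ) {k : ℕ} {ω : Ω} (ha : 0 ≤ S.a k)
    (hb : 0 ≤ S.b k) (hl : specNorm (S.lap k ω) ≤ ρ) :
    specNorm (S.driftMat k ω) ≤ (S.a k + S.b k) * S.driftScale ρ k ω := by
  refine (S.specNorm_driftMat_le k ω ha hb).trans ?_
  unfold driftScale
  have h0 := sum_specNorm_single_nonneg (N := N) (n := n)
  set K := ∑ x : Fin N × Fin n, ∑ y : Fin N × Fin n, specNorm (Matrix.single x y (1 : ℝ))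
  have h1 := mul_le_mul_of_nonneg_left (mul_le_mul_of_nonneg_right hl h0) hb
  have h2 := mul_nonneg hb (specNorm_nonneg (S.gram k ω))
  have h3 := mul_nonneg ha (mul_nonneg hρ h0)
  linarith

/-- Only a second moment of the Gram norm is needed, and `x² ≤ 1 + x ^ q` for `x ≥ 0` and `q ≥ 2`.
-/
lemma driftScale_sq_le (ρ : ℝ) (h k : ℕ) (ω : Ω) : S.driftScale ρ k ω ^ 2
    ≤ 2 * (1 + ρ * ∑ x : Fin N × Fin n, ∑ y : Fin N × Fin n,
      specNorm (Matrix.single x y (1 : ℝ))) ^ 2 + 2 + 2 * S.gramPow h k ω := by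
  have h1 : ∀ x : ℝ, 0 ≤ x → x ^ 2 ≤ 1 + x ^ 2 ^ max h 2 := fun x hx => by
    rcases le_total x 1 with hx1 | hx1
    · have := pow_nonneg hx (2 ^ max h 2)
      nlinarith
    · have : 2 ≤ 2 ^ max h 2 := le_self_pow₀ (by norm_num) (by positivity)
      linarith [pow_le_pow_right₀ hx1 this]
  have h2 := h1 _ (specNorm_nonneg (S.gram k ω))
  refine add_sq_le.trans ?_
  unfold gramPow
  linarith

section Instance

variable [mΩ : MeasurableSpace Ω] {μ : Measure Ω} [IsProbabilityMeasure μ]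

lemma measurable_driftScale {k : ℕ} (hH : ∀ i p q, Measurable fun ω => S.H i k ω p q) (ρ : ℝ) :
    Measurable (S.driftScale ρ k) :=
  (measurable_specNorm (S.measurable_gram hH)).const_add _

lemma integrable_driftScale_sq (hmeas : S.IsMeasurable) {h : ℕ}
    (h_int : ∀ k, Integrable (S.gramPow h k) μ) (ρ : ℝ) (k : ℕ) :
    Integrable (fun ω => S.driftScale ρ k ω ^ 2) μ := by
  refine ((integrable_const (2 * (1 + ρ * ∑ x : Fin N × Fin n, ∑ y : Fin N × Fin n,
    specNorm (Matrix.single x y (1 : ℝ))) ^ 2 + 2)).add ((h_int k).const_mul 2)).mono'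
    ((S.measurable_driftScale (fun i => hmeas.H i k) ρ).pow_const 2).aestronglyMeasurable
    (ae_of_all _ fun ω => ?_)
  rw [Real.norm_of_nonneg (sq_nonneg _)]
  exact S.driftScale_sq_le ρ h k ω

lemma integrable_specNorm_gram (hmeas : S.IsMeasurable) {h : ℕ}
    (h_int : ∀ k, Integrable (S.gramPow h k) μ) (k : ℕ) :
    Integrable (fun ω => specNorm (S.gram k ω)) μ := by
  refine (S.integrable_driftScale_sq hmeas h_int 0 k).mono'
    (measurable_specNorm (S.measurable_gram fun i => hmeas.H i k)).aestronglyMeasurable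
    (ae_of_all _ fun ω => ?_)
  have h1 := S.specNorm_gram_add_one_le_driftScale le_rfl k ω
  have h2 := specNorm_nonneg (S.gram k ω)
  rw [Real.norm_of_nonneg h2]
  nlinarith

lemma condExp_driftScale_sq_le {h : ℕ} (hmeas : S.IsMeasurable)
    (h_int : ∀ k, Integrable (S.gramPow h k) μ) (ρ : ℝ) {B : ℝ}
    (hB : ∀ᵐ ω ∂μ, ∀ k, (μ[S.gramPow h k | S.past k]) ω ≤ B) (k : ℕ) :
    ∀ᵐ ω ∂μ, (μ[fun ω => S.driftScale ρ k ω ^ 2 | S.past k]) ω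
      ≤ 2 * (1 + ρ * ∑ x : Fin N × Fin n, ∑ y : Fin N × Fin n,
      specNorm (Matrix.single x y (1 : ℝ))) ^ 2 + 2 + 2 * B := by
  set c₀ := 2 * (1 + ρ * ∑ x : Fin N × Fin n, ∑ y : Fin N × Fin n,
      specNorm (Matrix.single x y (1 : ℝ))) ^ 2 + 2
  have h1 : μ[fun ω => S.driftScale ρ k ω ^ 2 | S.past k] ≤ᵐ[μ]
      μ[(fun _ => c₀) + (2 : ℝ) • S.gramPow h k | S.past k] :=
    condExp_mono (S.integrable_driftScale_sq hmeas h_int ρ k)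
      ((integrable_const _).add ((h_int k).smul (2 : ℝ)))
      (ae_of_all _ fun ω => S.driftScale_sq_le ρ h k ω)
  have h2 := condExp_add (μ := μ) (integrable_const c₀) ((h_int k).smul (2 : ℝ)) (S.past k)
  have h3 := condExp_smul (μ := μ) (2 : ℝ) (S.gramPow h k) (S.past k)
  filter_upwards [h1, h2, h3, hB] with ω e1 e2 e3 e4
  rw [e2, Pi.add_apply, e3, condExp_const (S.past_le hmeas k), Pi.smul_apply, smul_eq_mul] at e1
  linarith [e4 k]

/-- The error recursion satisfies the conditional moment bounds. -/
lemma exists_isPerturbedRecursion (hmeas : S.IsMeasurable) (hA1 : S.LinearGrowth)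
    (hA2 : S.NoiseCondition μ)
    (ha : ∀ k, 0 ≤ S.a k) (hb : ∀ k, 0 ≤ S.b k) (hlam : ∀ k, 0 ≤ S.lam k)
    (ha_anti : Antitone S.a) (hb_anti : Antitone S.b) (hlam_anti : Antitone S.lam)
    {h : ℕ} {ρ B : ℝ} (hρ : 0 ≤ ρ) (hB0 : 0 ≤ B) (h_int : ∀ k, Integrable (S.gramPow h k) μ)
    (hlap : ∀ᵐ ω ∂μ, ∀ k, specNorm (S.lap k ω) ≤ ρ)
    (hB : ∀ᵐ ω ∂μ, ∀ k, (μ[S.gramPow h k | S.past k]) ω ≤ B) :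
    ∃ C, IsPerturbedRecursion μ (S.pastFiltration hmeas) S.err S.noiseTerm
      (fun k ω => Matrix.toEuclideanCLM (n := Fin N × Fin n) (𝕜 := ℝ) (S.driftMat k ω))
      (S.driftScale ρ) S.stackedParam (fun k => S.a k + S.b k) S.lam C := by
  obtain ⟨σ, b₀, hσ⟩ := hA1
  obtain ⟨β', hβ'⟩ := hA2.bounded
  set β := max β' 0
  have hβ0 : 0 ≤ β := le_max_right _ _
  have hβ : ∀ k, ∀ᵐ ω ∂μ, (μ[S.noiseSq k | S.pastNoiseAndDesign k]) ω ≤ β := fun k => by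
    filter_upwards [S.condExp_noiseSq hmeas hA2 k, hβ' k] with ω h1 h2
    rw [h1]; exact h2.trans (le_max_left _ _)
  set κ := 8 * σ ^ 2 + 2 * b₀ ^ 2
  have hκ : 0 ≤ κ := by positivity
  set C₁ := 2 * (1 + ρ * ∑ x : Fin N × Fin n, ∑ y : Fin N × Fin n,
      specNorm (Matrix.single x y (1 : ℝ))) ^ 2 + 2 + 2 * B
  have hC₁ : 0 ≤ C₁ := by positivity
  set K₂ : ℝ := 2 * (N * n)
  have hK₂ : 0 ≤ K₂ := by positivity
  set K₃ : ℝ := 2 * (N * n) * (N * (ρ ^ 2 * κ))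
  have hK₃ : 0 ≤ K₃ := by positivity
  have hpast := S.past_le hmeas
  have hdes := S.pastNoiseAndDesign_le hmeas
  have hest : ∀ k i, Measurable fun ω => S.est k ω i := fun k i =>
    (S.measurable_est_past hmeas.f k i).mono (hpast k) le_rfl
  have herr : ∀ k, Measurable[S.past k] (S.err k) := S.measurable_err_past hmeas.f
  have herrm : ∀ k, Measurable (S.err k) := fun k => (herr k).mono (hpast k) le_rfl
  have hsi := S.integrable_driftScale_sq hmeas h_int ρ
  have hsc := S.condExp_driftScale_sq_le hmeas h_int ρ hB
  have hgi := S.integrable_specNorm_gram hmeas h_int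
  have hnm : ∀ k, Measurable (S.noiseTerm k) := fun k =>
    S.measurable_noiseTerm (hmeas.adj k) (fun i => hmeas.H i k) (fun i => hmeas.v i k)
      (fun j i => hmeas.ξ j i k) hmeas.f (hest k)
  have hHd : ∀ k i p q, Measurable[S.pastNoiseAndDesign k] fun ω => S.H i k ω p q :=
    fun k i p q => (S.measurable_H_sigmaGH k i p q).mono (S.sigmaGH_le_pastNoiseAndDesign k) le_rfl
  have hAd : ∀ k i j, Measurable[S.pastNoiseAndDesign k] fun ω => S.adj k ω i j :=
    fun k i j => (S.measurable_adj_sigmaGH k i j).mono (S.sigmaGH_le_pastNoiseAndDesign k) le_rfl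
  have hgd : ∀ k, Measurable[S.pastNoiseAndDesign k] fun ω => specNorm (S.gram k ω) := fun k =>
    @measurable_specNorm _ _ _ Ω (S.pastNoiseAndDesign k) _
      (@measurable_gram Ω N n m S (S.pastNoiseAndDesign k) k (hHd k))
  have hWd : ∀ k, StronglyMeasurable[S.pastNoiseAndDesign k] fun ω => 1 + ‖S.err k ω‖ ^ 2 :=
    fun k => (((measurable_norm.pow_const 2).const_add 1).comp
      ((herr k).mono (S.past_le_pastNoiseAndDesign k) le_rfl)).stronglyMeasurable
  have hz0 : ∀ k, ∀ᵐ ω ∂μ, 0 ≤ S.noiseSq k ω := fun k => ae_of_all _ (S.noiseSq_nonneg k)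
  have hgz : ∀ k, Integrable (fun ω => specNorm (S.gram k ω) * S.noiseSq k ω) μ := fun k =>
    integrable_mul_of_condExp_le (hdes k) (hgd k).stronglyMeasurable (hgi k)
      (fun _ => specNorm_nonneg _) (hA2.integrable_sq k) (hz0 k) (hβ k)
  have hW0 : ∀ k ω, 0 ≤ 1 + ‖S.err k ω‖ ^ 2 := fun k ω => by positivity
  have hWz : ∀ k, Integrable (fun ω => ‖S.err k ω‖ ^ 2) μ →
      Integrable (fun ω => (1 + ‖S.err k ω‖ ^ 2) * S.noiseSq k ω) μ := fun k hk =>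
    integrable_mul_of_condExp_le (hdes k) (hWd k) ((integrable_const 1).add hk)
      (hW0 k) (hA2.integrable_sq k) (hz0 k) (hβ k)
  have hbound : ∀ᵐ ω ∂μ, ∀ k, ‖S.noiseTerm k ω‖ ^ 2 ≤ (S.a k + S.b k) ^ 2 *
      (K₂ * (specNorm (S.gram k ω) * S.noiseSq k ω)
        + K₃ * ((1 + ‖S.err k ω‖ ^ 2) * S.noiseSq k ω)) := by
    filter_upwards [hlap] with ω hω k
    exact S.norm_noiseTerm_sq_le hσ k ω (ha k) (hb k) (hω k)
  have hnint : ∀ k, Integrable (fun ω => ‖S.err k ω‖ ^ 2) μ →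
      Integrable (fun ω => ‖S.noiseTerm k ω‖ ^ 2) μ := fun k hk => by
    refine ((((hgz k).const_mul K₂).add ((hWz k hk).const_mul K₃)).const_mul
      ((S.a k + S.b k) ^ 2)).mono' ((hnm k).norm.pow_const 2).aestronglyMeasurable ?_
    filter_upwards [hbound] with ω hω
    rw [Real.norm_of_nonneg (sq_nonneg _)]
    exact hω k
  -- `C₁` bounds the squared scale. In the noise, `β` bounds `noiseSq`, the Gram norm averages to at
  -- most `C₁`, and `K₃` goes with `1 + ‖err‖²`.
  refine ⟨C₁ + β * (K₂ * C₁ + K₃), ?_⟩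
  have hCC : C₁ ≤ C₁ + β * (K₂ * C₁ + K₃) := le_add_of_nonneg_right (by positivity)
  refine
    { recursion := S.err_succ
      adapted := herr
      integrable_zero := integrable_const
        (‖(WithLp.toLp 2 fun ip => S.init ip.1 ip.2 - S.x₀ ip.2 :
          EuclideanSpace ℝ (Fin N × Fin n))‖ ^ 2)
      measurable_noise := hnm
      measurable_drift := fun k X hX => ?_
      one_le := fun k ω => ?_
      integrable_scale := hsi
      condExp_scale := fun k => (hsc k).mono fun ω hω => hω.trans hCC
      norm_drift := ?_
      integrable_noise := hnint
      noise_le := fun k hk A hA => ?_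
      noise_orthogonal := fun k hk A hA => ?_
      const_nonneg := hC₁.trans hCC
      gain_nonneg := fun k => add_nonneg (ha k) (hb k)
      lam_nonneg := hlam
      gain_antitone := fun i j hij => add_le_add (ha_anti hij) (hb_anti hij)
      lam_antitone := hlam_anti }
  · have hD := S.measurable_driftMat (hmeas.adj k) fun i => hmeas.H i k
    have : Measurable fun ω => WithLp.toLp 2 (S.driftMat k ω *ᵥ (X ω).ofLp) := by
      refine (WithLp.measurable_toLp 2 (Fin N × Fin n → ℝ)).comp
        (measurable_pi_iff.2 fun x => ?_)
      simp only [Matrix.mulVec, dotProduct]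
      fun_prop
    exact this
  · linarith [S.specNorm_gram_add_one_le_driftScale hρ k ω, specNorm_nonneg (S.gram k ω)]
  · filter_upwards [hlap] with ω hω k x
    exact (ContinuousLinearMap.le_opNorm _ _).trans (mul_le_mul_of_nonneg_right
      (S.specNorm_driftMat_le_driftScale hρ (ha k) (hb k) (hω k)) (norm_nonneg _))
  · have hA' : MeasurableSet[S.pastNoiseAndDesign k] A := S.past_le_pastNoiseAndDesign k _ hA
    have i1 := (hgz k).const_mul K₂
    have i2 := (hWz k hk).const_mul K₃
    have e1 := setIntegral_mono_ae (s := A) (hnint k hk).integrableOn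
      ((i1.fun_add i2).const_mul ((S.a k + S.b k) ^ 2)).integrableOn
      (hbound.mono fun ω hω => hω k)
    rw [integral_const_mul, integral_add i1.integrableOn i2.integrableOn, integral_const_mul,
      integral_const_mul] at e1
    have e2 := setIntegral_mul_le_of_condExp_le (hdes k) (hgd k).stronglyMeasurable (hgi k)
      (fun _ => specNorm_nonneg _) (hA2.integrable_sq k) (hz0 k) (hβ k) hA'
    have e3 := setIntegral_mul_le_of_condExp_le (hdes k) (hWd k) ((integrable_const 1).add hk)
      (hW0 k) (hA2.integrable_sq k) (hz0 k) (hβ k) hA'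
    have e4 : ∫ ω in A, specNorm (S.gram k ω) ∂μ ≤ ∫ ω in A, 1 * S.driftScale ρ k ω ^ 2 ∂μ := by
      refine integral_mono (hgi k).integrableOn ((hsi k).const_mul 1).integrableOn fun ω => ?_
      have h1 := S.specNorm_gram_add_one_le_driftScale hρ k ω
      have h2 := specNorm_nonneg (S.gram k ω)
      change specNorm (S.gram k ω) ≤ 1 * S.driftScale ρ k ω ^ 2
      nlinarith
    have e5 := setIntegral_mul_le_of_condExp_le (μ := μ) (hpast k)
      (X := fun _ => 1) stronglyMeasurable_const (integrable_const _)
      (fun _ => zero_le_one) (hsi k) (ae_of_all _ fun _ => sq_nonneg _) (hsc k) hA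
    have e6 : ∫ _ in A, (1 : ℝ) ∂μ ≤ ∫ ω in A, (1 + ‖S.err k ω‖ ^ 2) ∂μ :=
      integral_mono (integrable_const _) ((integrable_const 1).add hk).integrableOn
        fun ω => by simp
    set w := ∫ ω in A, (1 + ‖S.err k ω‖ ^ 2) ∂μ
    have hw : 0 ≤ w := integral_nonneg (hW0 k)
    have e7 : ∫ ω in A, specNorm (S.gram k ω) ∂μ ≤ C₁ * w :=
      e4.trans (e5.trans (mul_le_mul_of_nonneg_left e6 hC₁))
    have e8 := mul_le_mul_of_nonneg_left (e2.trans (mul_le_mul_of_nonneg_left e7 hβ0)) hK₂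
    have e9 := mul_le_mul_of_nonneg_left e3 hK₃
    refine e1.trans ((mul_le_mul_of_nonneg_left (add_le_add e8 e9) (sq_nonneg _)).trans ?_)
    have := mul_nonneg hC₁ (mul_nonneg (sq_nonneg (S.a k + S.b k)) hw)
    linarith
  · have hA' : MeasurableSet[S.pastNoiseAndDesign k] A := S.past_le_pastNoiseAndDesign k _ hA
    have hed : ∀ x, Measurable[S.pastNoiseAndDesign k] fun ω => S.err k ω x := fun x =>
      (EuclideanSpace.proj (𝕜 := ℝ) x).measurable.comp
        ((herr k).mono (S.past_le_pastNoiseAndDesign k) le_rfl)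
    have hfd : ∀ j i, Measurable[S.pastNoiseAndDesign k]
        fun ω => S.f j i (S.est k ω j - S.est k ω i) := fun j i => by
      have h1 := (S.measurable_est_past hmeas.f k j).mono (S.past_le_pastNoiseAndDesign k) le_rfl
      have h2 := (S.measurable_est_past hmeas.f k i).mono (S.past_le_pastNoiseAndDesign k) le_rfl
      exact (hmeas.f j i).comp (h1.sub h2)
    have hscale : Integrable (fun ω => ‖S.err k ω‖ ^ 2 * S.driftScale ρ k ω ^ 2) μ :=
      integrable_mul_of_condExp_le (hpast k)
        ((measurable_norm.pow_const 2).comp (herr k)).stronglyMeasurable hk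
        (fun _ => sq_nonneg _) (hsi k) (ae_of_all _ fun _ => sq_nonneg _) (hsc k)
    -- The inner product is split into scalar terms, each a factor known given `pastNoiseAndDesign`
    -- times one noise coordinate of conditional mean zero.
    have hv : ∀ i p r, Integrable (fun ω =>
        S.a k * S.err k ω (i, p) * S.H i k ω r p * S.v i k ω r) μ ∧
        ∫ ω in A, S.a k * S.err k ω (i, p) * S.H i k ω r p * S.v i k ω r ∂μ = 0 := by
      intro i p r
      have hX : Measurable[S.pastNoiseAndDesign k]
          fun ω => S.a k * S.err k ω (i, p) * S.H i k ω r p :=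
        ((hed (i, p)).const_mul _).mul (hHd k i r p)
      have hvi := (EuclideanSpace.proj (𝕜 := ℝ) r).integrable_comp (hA2.integrable_v i k)
      have hint : Integrable (fun ω =>
          S.a k * S.err k ω (i, p) * S.H i k ω r p * S.v i k ω r) μ := by
        refine ((hscale.const_mul (S.a k ^ 2)).add (hA2.integrable_sq k)).mono'
          ((hX.mono (hdes k) le_rfl).aestronglyMeasurable.mul hvi.1) (ae_of_all _ fun ω => ?_)
        have h1 := S.sq_err_apply_le k ω (i, p)
        have h2 : S.H i k ω r p ^ 2 ≤ S.driftScale ρ k ω ^ 2 := by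
          have g1 : S.H i k ω r p ^ 2 ≤ _ := (Finset.single_le_sum (f := fun r => S.H i k ω r p ^ 2)
            (fun _ _ => sq_nonneg _) (Finset.mem_univ r)).trans (S.sum_sq_H_le k ω i p)
          have g2 := S.specNorm_gram_add_one_le_driftScale hρ k ω
          have g3 := specNorm_nonneg (S.gram k ω)
          nlinarith
        have h3 := (sq_apply_le_sq_norm (S.v i k ω) r).trans (S.sq_v_le_noiseSq k ω i)
        have h4 := mul_le_mul_of_nonneg_left
          (mul_le_mul h1 h2 (sq_nonneg _) (sq_nonneg _)) (sq_nonneg (S.a k))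
        rw [Real.norm_eq_abs]
        change _ ≤ S.a k ^ 2 * (‖S.err k ω‖ ^ 2 * S.driftScale ρ k ω ^ 2) + S.noiseSq k ω
        rw [abs_le]
        constructor <;> nlinarith [
          sq_nonneg (S.a k * S.err k ω (i, p) * S.H i k ω r p + S.v i k ω r),
          sq_nonneg (S.a k * S.err k ω (i, p) * S.H i k ω r p - S.v i k ω r),
          sq_nonneg (S.a k * S.err k ω (i, p) * S.H i k ω r p), sq_nonneg (S.v i k ω r)]
      exact ⟨hint, setIntegral_mul_eq_zero_of_condExp_eq_zero (hdes k) hX.stronglyMeasurable hint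
        hvi (S.condExp_v_apply hmeas hA2 k i r) hA'⟩
    have hξ : ∀ i p j, Integrable (fun ω => S.b k * S.err k ω (i, p) * S.adj k ω i j *
          S.f j i (S.est k ω j - S.est k ω i) * S.ξ j i k ω p) μ ∧
        ∫ ω in A, S.b k * S.err k ω (i, p) * S.adj k ω i j *
          S.f j i (S.est k ω j - S.est k ω i) * S.ξ j i k ω p ∂μ = 0 := by
      intro i p j
      have hX : Measurable[S.pastNoiseAndDesign k]
          fun ω => S.b k * S.err k ω (i, p) * S.adj k ω i j *
            S.f j i (S.est k ω j - S.est k ω i) :=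
        (((hed (i, p)).const_mul _).mul (hAd k i j)).mul (hfd j i)
      have hξi := (EuclideanSpace.proj (𝕜 := ℝ) p).integrable_comp (hA2.integrable_ξ j i k)
      have hint : Integrable (fun ω => S.b k * S.err k ω (i, p) * S.adj k ω i j *
            S.f j i (S.est k ω j - S.est k ω i) * S.ξ j i k ω p) μ := by
        refine ((hk.const_mul (S.b k ^ 2 * ρ ^ 2)).add ((hWz k hk).const_mul κ)).mono'
          ((hX.mono (hdes k) le_rfl).aestronglyMeasurable.mul hξi.1) ?_
        filter_upwards [hlap] with ω hω
        have h1 := S.sq_err_apply_le k ω (i, p)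
        have h2 : S.adj k ω i j ^ 2 ≤ ρ ^ 2 := by
          rw [← sq_abs]
          exact pow_le_pow_left₀ (abs_nonneg _)
            ((S.abs_adj_le_specNorm_lap k ω i j).trans (hω k)) 2
        have h3 : S.ξ j i k ω p ^ 2 ≤ S.noiseSq k ω :=
          ((sq_apply_le_sq_norm (S.ξ j i k ω) p).trans (Finset.single_le_sum
            (f := fun j => ‖S.ξ j i k ω‖ ^ 2) (fun _ _ => sq_nonneg _)
            (Finset.mem_univ j))).trans (S.sum_sq_ξ_le_noiseSq k ω i)
        have h4 := mul_le_mul_of_nonneg_left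
          (mul_le_mul h2 h1 (sq_nonneg _) (sq_nonneg _)) (sq_nonneg (S.b k))
        have h5 := mul_le_mul (S.sq_intensity_le hσ k ω j i) h3 (sq_nonneg _)
          (mul_nonneg hκ (hW0 k ω))
        rw [Real.norm_eq_abs]
        change _ ≤ S.b k ^ 2 * ρ ^ 2 * ‖S.err k ω‖ ^ 2
          + κ * ((1 + ‖S.err k ω‖ ^ 2) * S.noiseSq k ω)
        -- The intensity is grouped with the noise, not with the error: squaring the product of
        -- error and intensity would call for a fourth moment of the error.
        set u := S.b k * S.err k ω (i, p) * S.adj k ω i j with hu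
        set t := S.f j i (S.est k ω j - S.est k ω i) * S.ξ j i k ω p with ht
        rw [mul_assoc u, ← ht, abs_le]
        have h6 : u ^ 2 ≤ S.b k ^ 2 * ρ ^ 2 * ‖S.err k ω‖ ^ 2 := by
          rw [hu]; linarith
        have h7 : t ^ 2 ≤ κ * ((1 + ‖S.err k ω‖ ^ 2) * S.noiseSq k ω) := by
          rw [ht, mul_pow]; linarith
        constructor <;> nlinarith [sq_nonneg (u + t), sq_nonneg (u - t), sq_nonneg u, sq_nonneg t]
      exact ⟨hint, setIntegral_mul_eq_zero_of_condExp_eq_zero (hdes k) hX.stronglyMeasurable hint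
        hξi (S.condExp_ξ_apply hmeas hA2 k j i p) hA'⟩
    simp only [inner_noiseTerm]
    have j1 : ∀ i p, Integrable (fun ω => ∑ r, S.a k * S.err k ω (i, p) * S.H i k ω r p *
        S.v i k ω r) μ := fun i p => integrable_finsetSum _ fun r _ => (hv i p r).1
    have j2 : ∀ i p, Integrable (fun ω => ∑ j, S.b k * S.err k ω (i, p) * S.adj k ω i j *
        S.f j i (S.est k ω j - S.est k ω i) * S.ξ j i k ω p) μ :=
      fun i p => integrable_finsetSum _ fun r _ => (hξ i p r).1
    rw [integral_finsetSum _ fun i _ => (integrable_finsetSum _ fun p _ =>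
      (j1 i p).fun_add (j2 i p)).integrableOn]
    refine Finset.sum_eq_zero fun i _ => ?_
    rw [integral_finsetSum _ fun p _ => ((j1 i p).fun_add (j2 i p)).integrableOn]
    refine Finset.sum_eq_zero fun p _ => ?_
    rw [integral_add (j1 i p).integrableOn (j2 i p).integrableOn,
      integral_finsetSum _ fun r _ => (hv i p r).1.integrableOn,
      integral_finsetSum _ fun j _ => (hξ i p j).1.integrableOn,
      Finset.sum_eq_zero fun r _ => (hv i p r).2, Finset.sum_eq_zero fun j _ => (hξ i p j).2,
      add_zero]

end Instance

end Model

/-! ### The conditional information matrix. -/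

/-- The antisymmetric part drops out of a quadratic form. This is what exchanges the Laplacian of
the drift for the symmetrized one, whose smallest eigenvalue is assumed under control. -/
lemma sum_symmetrize {ι : Type*} [Fintype ι] (x : ι → ℝ) (B : ι → ι → ℝ) :
    ∑ p, ∑ q, x p * x q * (1 / 2 * (B p q + B q p)) = ∑ p, ∑ q, x p * x q * B p q := by
  have h1 : ∑ p, ∑ q, x p * x q * B q p = ∑ p, ∑ q, x p * x q * B p q := by
    rw [Finset.sum_comm]
    exact Finset.sum_congr rfl fun _ _ => Finset.sum_congr rfl fun _ _ => by ring
  have h2 : ∀ p q, x p * x q * (1 / 2 * (B p q + B q p))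
      = 1 / 2 * (x p * x q * B p q) + 1 / 2 * (x p * x q * B q p) := fun p q => by ring
  simp only [h2, Finset.sum_add_distrib, ← Finset.mul_sum, h1]
  ring

/-- Linearity of the conditional expectation with coefficients measurable for the conditioning
σ-algebra. -/
lemma condExp_sum_mul {Ω κ : Type*} [Countable κ] {m mΩ : MeasurableSpace Ω} {μ : Measure Ω}
    (T : Finset κ) {X Y : κ → Ω → ℝ} (hX : ∀ t, StronglyMeasurable[m] (X t))
    (hY : ∀ t, Integrable (Y t) μ) (hXY : ∀ t, Integrable (fun ω => X t ω * Y t ω) μ) :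
    ∀ᵐ ω ∂μ, (μ[fun ω => ∑ t ∈ T, X t ω * Y t ω | m]) ω = ∑ t ∈ T, X t ω * (μ[Y t | m]) ω := by
  have h0 : (fun ω => ∑ t ∈ T, X t ω * Y t ω) = ∑ t ∈ T, X t * Y t := by
    funext ω
    simp
  have h1 : ∀ᵐ ω ∂μ, ∀ t, (μ[X t * Y t | m]) ω = X t ω * (μ[Y t | m]) ω :=
    ae_all_iff.2 fun t => condExp_mul_of_stronglyMeasurable_left (hX t) (hXY t) (hY t)
  rw [h0]
  filter_upwards [condExp_finsetSum (fun t (_ : t ∈ T) => hXY t) m, h1] with ω g0 g1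
  refine g0.trans ?_
  rw [Finset.sum_apply]
  exact Finset.sum_congr rfl fun t _ => g1 t

namespace Model

variable {Ω : Type*} {N n : ℕ} {m : Fin N → ℕ} (S : Model Ω N n m)

lemma symLap_apply (k : ℕ) (ω : Ω) (i j : Fin N) :
    S.symLap k ω i j = 1 / 2 * (S.lap k ω i j + S.lap k ω j i) := by
  simp [symLap]

lemma symLap_comm (k : ℕ) (ω : Ω) (i j : Fin N) : S.symLap k ω i j = S.symLap k ω j i := by
  rw [symLap_apply, symLap_apply, add_comm]

lemma gram_comm (k : ℕ) (ω : Ω) (x y : Fin N × Fin n) : S.gram k ω x y = S.gram k ω y x := by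
  have : (S.gram k ω)ᵀ = S.gram k ω := by
    rw [gram, Matrix.transpose_mul, Matrix.transpose_transpose]
  conv_lhs => rw [← this]
  rfl

variable [mΩ : MeasurableSpace Ω] {μ : Measure Ω}

/-- The conditional information matrix over a window. -/
noncomputable def infoMat (μ : Measure Ω) (h k : ℕ) (ω : Ω) :
    Matrix (Fin N × Fin n) (Fin N × Fin n) ℝ :=
  ∑ i ∈ Finset.Ico (k * h) ((k + 1) * h),
    (S.b i • (condExpMat μ (S.past (k * h)) (S.symLap i) ω ⊗ₖ (1 : Matrix (Fin n) (Fin n) ℝ))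
      + S.a i • condExpMat μ (S.past (k * h)) (S.gram i) ω)

lemma infoMat_apply (h k : ℕ) (ω : Ω) (x y : Fin N × Fin n) :
    S.infoMat μ h k ω x y = ∑ i ∈ Finset.range h,
      (S.b (k * h + i) * ((μ[fun ω' => S.symLap (k * h + i) ω' x.1 y.1 | S.past (k * h)]) ω
        * (1 : Matrix (Fin n) (Fin n) ℝ) x.2 y.2)
      + S.a (k * h + i) * (μ[fun ω' => S.gram (k * h + i) ω' x y | S.past (k * h)]) ω) := by
  rw [infoMat, Finset.sum_Ico_eq_sum_range, Nat.add_mul, one_mul, Nat.add_sub_cancel_left,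
    Matrix.sum_apply]
  rfl

lemma isHermitian_infoMat (h k : ℕ) (ω : Ω) : (S.infoMat μ h k ω).IsHermitian := by
  refine Matrix.IsHermitian.ext fun x y => ?_
  rw [star_trivial, infoMat_apply, infoMat_apply]
  simp only [S.symLap_comm _ _ y.1 x.1, S.gram_comm _ _ y x, Matrix.one_apply,
    eq_comm (a := y.2) (b := x.2)]

variable [IsProbabilityMeasure μ]

lemma integrable_lap (hmeas : S.IsMeasurable) {ρ : ℝ}
    (hlap : ∀ᵐ ω ∂μ, ∀ k, specNorm (S.lap k ω) ≤ ρ) (k : ℕ) (i j : Fin N) :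
    Integrable (fun ω => S.lap k ω i j) μ := by
  refine Integrable.of_bound (S.measurable_lap (hmeas.adj k) i j).aestronglyMeasurable ρ ?_
  filter_upwards [hlap] with ω hω
  exact (abs_entry_le_specNorm _ _ _).trans (hω k)

lemma integrable_gram (hmeas : S.IsMeasurable) {h : ℕ}
    (h_int : ∀ k, Integrable (S.gramPow h k) μ) (k : ℕ) (x y : Fin N × Fin n) :
    Integrable (fun ω => S.gram k ω x y) μ :=
  (S.integrable_specNorm_gram hmeas h_int k).mono'
    (S.measurable_gram (fun i => hmeas.H i k) x y).aestronglyMeasurable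
    (ae_of_all _ fun _ => abs_entry_le_specNorm _ _ _)

omit [IsProbabilityMeasure μ] in
lemma condExp_symLap {F : MeasurableSpace Ω} {k : ℕ}
    (hl : ∀ i j, Integrable (fun ω => S.lap k ω i j) μ) (i j : Fin N) :
    ∀ᵐ ω ∂μ, (μ[fun ω => S.symLap k ω i j | F]) ω
      = 1 / 2 * ((μ[fun ω => S.lap k ω i j | F]) ω + (μ[fun ω => S.lap k ω j i | F]) ω) := by
  have h0 : (fun ω => S.symLap k ω i j)
      = (1 / 2 : ℝ) • ((fun ω => S.lap k ω i j) + fun ω => S.lap k ω j i) := by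
    funext ω
    rw [symLap_apply]; rfl
  rw [h0]
  filter_upwards [condExp_smul (μ := μ) (1 / 2 : ℝ)
    ((fun ω => S.lap k ω i j) + fun ω => S.lap k ω j i) F,
    condExp_add (hl i j) (hl j i) F] with ω h1 h2
  rw [h1, Pi.smul_apply, h2, Pi.add_apply, smul_eq_mul]

lemma integrable_driftMat (hmeas : S.IsMeasurable) {h : ℕ} {ρ : ℝ}
    (h_int : ∀ k, Integrable (S.gramPow h k) μ)
    (hlap : ∀ᵐ ω ∂μ, ∀ k, specNorm (S.lap k ω) ≤ ρ) (k : ℕ) (x y : Fin N × Fin n) :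
    Integrable (fun ω => S.driftMat k ω x y) μ :=
  (((S.integrable_lap hmeas hlap k x.1 y.1).mul_const
    ((1 : Matrix (Fin n) (Fin n) ℝ) x.2 y.2)).const_mul (S.b k)).add
    ((S.integrable_gram hmeas h_int k x y).const_mul (S.a k))

lemma condExp_driftMat (hmeas : S.IsMeasurable) {h l : ℕ} {ρ : ℝ}
    (h_int : ∀ k, Integrable (S.gramPow h k) μ)
    (hlap : ∀ᵐ ω ∂μ, ∀ k, specNorm (S.lap k ω) ≤ ρ) (k : ℕ) (x y : Fin N × Fin n) :
    ∀ᵐ ω ∂μ, (μ[fun ω => S.driftMat k ω x y | S.past l]) ω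
      = S.b k * ((μ[fun ω => S.lap k ω x.1 y.1 | S.past l]) ω
          * (1 : Matrix (Fin n) (Fin n) ℝ) x.2 y.2)
        + S.a k * (μ[fun ω => S.gram k ω x y | S.past l]) ω := by
  set o := (1 : Matrix (Fin n) (Fin n) ℝ) x.2 y.2
  have h0 : (fun ω => S.driftMat k ω x y)
      = (S.b k * o) • (fun ω => S.lap k ω x.1 y.1) + S.a k • fun ω => S.gram k ω x y := by
    funext ω
    simp only [driftMat, Matrix.add_apply, Matrix.smul_apply, Matrix.kroneckerMap_apply,
      Pi.add_apply, Pi.smul_apply, smul_eq_mul]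
    ring
  rw [h0]
  filter_upwards [condExp_add ((S.integrable_lap hmeas hlap k x.1 y.1).smul (S.b k * o))
    ((S.integrable_gram hmeas h_int k x y).smul (S.a k)) (S.past l),
    condExp_smul (μ := μ) (S.b k * o) (fun ω => S.lap k ω x.1 y.1) (S.past l),
    condExp_smul (μ := μ) (S.a k) (fun ω => S.gram k ω x y) (S.past l)] with ω h1 h2 h3
  rw [h1, Pi.add_apply, h2, h3, Pi.smul_apply, Pi.smul_apply, smul_eq_mul, smul_eq_mul]
  ring

omit [IsProbabilityMeasure μ] in
lemma inner_infoMat (h k : ℕ) (ω : Ω) (x : EuclideanSpace ℝ (Fin N × Fin n))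
    (hs : ∀ l i j, (μ[fun ω => S.symLap l ω i j | S.past (k * h)]) ω
      = 1 / 2 * ((μ[fun ω => S.lap l ω i j | S.past (k * h)]) ω
        + (μ[fun ω => S.lap l ω j i | S.past (k * h)]) ω)) :
    inner ℝ x (Matrix.toEuclideanCLM (n := Fin N × Fin n) (𝕜 := ℝ) (S.infoMat μ h k ω) x)
      = ∑ i ∈ Finset.range h, ∑ p, ∑ q, x p * x q * (S.b (k * h + i) *
        ((μ[fun ω => S.lap (k * h + i) ω p.1 q.1 | S.past (k * h)]) ω
          * (1 : Matrix (Fin n) (Fin n) ℝ) p.2 q.2)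
        + S.a (k * h + i) * (μ[fun ω => S.gram (k * h + i) ω p q | S.past (k * h)]) ω) := by
  rw [inner_toEuclideanCLM_eq_sum]
  simp only [infoMat_apply, Finset.mul_sum]
  have hswap : ∀ f : Fin N × Fin n → Fin N × Fin n → ℕ → ℝ,
      ∑ p, ∑ q, ∑ i ∈ Finset.range h, f p q i = ∑ i ∈ Finset.range h, ∑ p, ∑ q, f p q i := by
    intro f
    rw [Finset.sum_comm (s := Finset.range h)]
    exact Finset.sum_congr rfl fun p _ => Finset.sum_comm
  rw [hswap]
  refine Finset.sum_congr rfl fun i _ => ?_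
  simp only [mul_add, Finset.sum_add_distrib]
  congr 1
  refine Eq.trans (Finset.sum_congr rfl fun p _ => Finset.sum_congr rfl fun q _ => ?_)
    (sum_symmetrize x.ofLp fun p q => S.b (k * h + i) *
      ((μ[fun ω => S.lap (k * h + i) ω p.1 q.1 | S.past (k * h)]) ω
        * (1 : Matrix (Fin n) (Fin n) ℝ) p.2 q.2))
  have h1 : (1 : Matrix (Fin n) (Fin n) ℝ) q.2 p.2 = (1 : Matrix (Fin n) (Fin n) ℝ) p.2 q.2 := by
    simp only [Matrix.one_apply, eq_comm]
  rw [hs, h1]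
  ring

/-- Permits conditioning the quadratic form entry by entry; the bound is `‖err‖²` times the squared
scale at the later time. -/
lemma integrable_err_mul_driftMat (hmeas : S.IsMeasurable) {h : ℕ} {ρ C : ℝ}
    (h_int : ∀ k, Integrable (S.gramPow h k) μ)
    (hlap : ∀ᵐ ω ∂μ, ∀ k, specNorm (S.lap k ω) ≤ ρ) (hρ : 0 ≤ ρ)
    (ha : ∀ k, 0 ≤ S.a k) (hb : ∀ k, 0 ≤ S.b k)
    (R : IsPerturbedRecursion μ (S.pastFiltration hmeas) S.err S.noiseTerm
      (fun k ω => Matrix.toEuclideanCLM (n := Fin N × Fin n) (𝕜 := ℝ) (S.driftMat k ω))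
      (S.driftScale ρ) S.stackedParam (fun k => S.a k + S.b k) S.lam C) {k l : ℕ} (hkl : k ≤ l)
    (x y : Fin N × Fin n) :
    Integrable (fun ω => S.err k ω x * S.err k ω y * S.driftMat l ω x y) μ := by
  have hem : Measurable (S.err k) := R.measurable k
  have hec : ∀ z, Measurable fun ω => S.err k ω z := fun z =>
    (EuclideanSpace.proj (𝕜 := ℝ) z).measurable.comp hem
  refine ((R.integrable_mul_scale hkl (R.adapted k) (R.integrable_sq k)).const_mul
    (S.a l + S.b l)).mono' ((((hec x).mul (hec y)).aestronglyMeasurable).mul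
      (S.integrable_driftMat hmeas h_int hlap l x y).1) ?_
  filter_upwards [hlap] with ω hω
  have h1 := S.sq_err_apply_le k ω x
  have h2 := S.sq_err_apply_le k ω y
  have h3 : |S.err k ω x * S.err k ω y| ≤ ‖S.err k ω‖ ^ 2 := by
    rw [abs_le]
    constructor <;> nlinarith [sq_nonneg (S.err k ω x + S.err k ω y),
      sq_nonneg (S.err k ω x - S.err k ω y)]
  have h4 : |S.driftMat l ω x y| ≤ (S.a l + S.b l) * S.driftScale ρ l ω :=
    (abs_entry_le_specNorm _ _ _).trans
      (S.specNorm_driftMat_le_driftScale hρ (ha _) (hb _) (hω _))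
  have h5 := R.one_le l ω
  have h6 : (S.a l + S.b l) * S.driftScale ρ l ω ≤ (S.a l + S.b l) * S.driftScale ρ l ω ^ 2 :=
    mul_le_mul_of_nonneg_left (by nlinarith) (add_nonneg (ha _) (hb _))
  rw [norm_mul, Real.norm_eq_abs, Real.norm_eq_abs]
  refine (mul_le_mul h3 (h4.trans h6) (abs_nonneg _) (sq_nonneg _)).trans_eq (by ring)

/-- The conditional quadratic form of the accumulated drift over a window is bounded below by
the smallest eigenvalue of the conditional information matrix. -/
lemma infoEig_mul_le (hmeas : S.IsMeasurable) {h : ℕ} {ρ C : ℝ}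
    (h_int : ∀ k, Integrable (S.gramPow h k) μ)
    (hlap : ∀ᵐ ω ∂μ, ∀ k, specNorm (S.lap k ω) ≤ ρ) (hρ : 0 ≤ ρ)
    (ha : ∀ k, 0 ≤ S.a k) (hb : ∀ k, 0 ≤ S.b k)
    (R : IsPerturbedRecursion μ (S.pastFiltration hmeas) S.err S.noiseTerm
      (fun k ω => Matrix.toEuclideanCLM (n := Fin N × Fin n) (𝕜 := ℝ) (S.driftMat k ω))
      (S.driftScale ρ) S.stackedParam (fun k => S.a k + S.b k) S.lam C) (k : ℕ) :
    ∀ᵐ ω ∂μ, S.infoEig μ h k ω * ‖S.err (k * h) ω‖ ^ 2 ≤ (μ[fun ω => ∑ i ∈ Finset.range h,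
      inner ℝ (S.err (k * h) ω) (Matrix.toEuclideanCLM (n := Fin N × Fin n) (𝕜 := ℝ)
        (S.driftMat (k * h + i) ω) (S.err (k * h) ω)) | S.pastFiltration hmeas (k * h)]) ω := by
  have hem : ∀ z, Measurable[S.past (k * h)] fun ω => S.err (k * h) ω z := fun z =>
    (EuclideanSpace.proj (𝕜 := ℝ) z).measurable.comp (S.measurable_err_past hmeas.f (k * h))
  -- The error at the start of the window is known, so only the drift entries are averaged. All
  -- steps and pairs of indices are treated as one finite sum.
  have hce := condExp_sum_mul (μ := μ) (m := S.past (k * h))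
    (Finset.range h ×ˢ (Finset.univ : Finset ((Fin N × Fin n) × (Fin N × Fin n))))
    (X := fun t ω => S.err (k * h) ω t.2.1 * S.err (k * h) ω t.2.2)
    (Y := fun t ω => S.driftMat (k * h + t.1) ω t.2.1 t.2.2)
    (fun t => ((hem t.2.1).mul (hem t.2.2)).stronglyMeasurable)
    (fun t => S.integrable_driftMat hmeas h_int hlap _ _ _)
    (fun t => S.integrable_err_mul_driftMat hmeas h_int hlap hρ ha hb R (Nat.le_add_right _ _) _ _)
  have hfun : ∀ ω, ∑ i ∈ Finset.range h,
      inner ℝ (S.err (k * h) ω) (Matrix.toEuclideanCLM (n := Fin N × Fin n) (𝕜 := ℝ)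
        (S.driftMat (k * h + i) ω) (S.err (k * h) ω))
      = ∑ t ∈ Finset.range h ×ˢ (Finset.univ : Finset ((Fin N × Fin n) × (Fin N × Fin n))),
        S.err (k * h) ω t.2.1 * S.err (k * h) ω t.2.2 *
          S.driftMat (k * h + t.1) ω t.2.1 t.2.2 := fun ω => by
    rw [Finset.sum_product]
    refine Finset.sum_congr rfl fun i _ => ?_
    rw [inner_toEuclideanCLM_eq_sum]
    exact (Fintype.sum_prod_type fun t : (Fin N × Fin n) × (Fin N × Fin n) =>
      S.err (k * h) ω t.1 * S.err (k * h) ω t.2 * S.driftMat (k * h + i) ω t.1 t.2).symm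
  simp only [hfun]
  have e2 : ∀ᵐ ω ∂μ, ∀ l p q, (μ[fun ω => S.driftMat l ω p q | S.past (k * h)]) ω = _ :=
    ae_all_iff.2 fun l => ae_all_iff.2 fun p => ae_all_iff.2 fun q =>
      S.condExp_driftMat hmeas (l := k * h) h_int hlap l p q
  have e3 : ∀ᵐ ω ∂μ, ∀ l i j, (μ[fun ω => S.symLap l ω i j | S.past (k * h)]) ω = _ :=
    ae_all_iff.2 fun l => ae_all_iff.2 fun i => ae_all_iff.2 fun j =>
      S.condExp_symLap (F := S.past (k * h)) (S.integrable_lap hmeas hlap l) i j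
  filter_upwards [hce, e2, e3] with ω g0 g2 g3
  refine (lambdaMin_mul_le (S.isHermitian_infoMat h k ω) (S.err (k * h) ω)).trans_eq ?_
  refine (S.inner_infoMat h k ω (S.err (k * h) ω) g3).trans (Eq.trans ?_ g0.symm)
  rw [Finset.sum_product]
  refine Finset.sum_congr rfl fun i _ => ?_
  refine Eq.trans (Finset.sum_congr rfl fun p _ => Finset.sum_congr rfl fun q _ => ?_)
    (Fintype.sum_prod_type fun t : (Fin N × Fin n) × (Fin N × Fin n) =>
      S.err (k * h) ω t.1 * S.err (k * h) ω t.2 *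
        (μ[fun ω => S.driftMat (k * h + i) ω t.1 t.2 | S.past (k * h)]) ω).symm
  rw [g2]

end Model

end DecentralizedRegression

/-! ### Conclusion. -/

theorem theorem1 {Ω : Type*} [MeasurableSpace Ω] (μ : Measure Ω) [IsProbabilityMeasure μ]
    {N n : ℕ} {m : Fin N → ℕ} (S : DecentralizedRegression.Model Ω N n m)
    (hmeas : S.IsMeasurable)
    -- growth of the noise intensity functions, and the conditions on the noises
    (hA1 : S.LinearGrowth) (hA2 : S.NoiseCondition μ)
    -- nonnegative gains, monotonically decreasing
    (ha : ∀ k, 0 ≤ S.a k) (hb : ∀ k, 0 ≤ S.b k) (hlam : ∀ k, 0 ≤ S.lam k)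
    (ha_anti : Antitone S.a) (hb_anti : Antitone S.b) (hlam_anti : Antitone S.lam)
    (h : ℕ) (hh : 0 < h) (ρ₀ : ℝ) (hρ₀ : 0 < ρ₀)
    -- (i) sample path spatio-temporal persistence of excitation
    (h_exc : ∀ᵐ ω ∂μ, Tendsto (fun K : ℕ => ∑ k ∈ Finset.range K, S.infoEig μ h k ω) atTop atTop)
    (h_inf : ∀ᵐ ω ∂μ, ∀ k, 0 ≤ S.infoEig μ h k ω + S.lam k)
    -- (ii) summability of the gains
    (h_sum : Summable fun k => S.a k ^ 2 + S.b k ^ 2 + S.lam k)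
    -- (iii) bounded Laplacians and bounded conditional moments of the Gram matrices
    (h_int : ∀ k, Integrable (S.gramPow h k) μ)
    (h_bdd : ∀ᵐ ω ∂μ, ∀ k, DecentralizedRegression.specNorm (S.lap k ω)
      + ((μ[S.gramPow h k | S.past k]) ω) ^ ((1 : ℝ) / 2 ^ max h 2) ≤ ρ₀) :
    ∀ᵐ ω ∂μ, ∀ i, Tendsto (fun k => S.est k ω i) atTop (𝓝 S.x₀) := by
  have hb2 := S.condExp_gramPow_le h_bdd
  have hlap : ∀ᵐ ω ∂μ, ∀ k, DecentralizedRegression.specNorm (S.lap k ω) ≤ ρ₀ :=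
    hb2.mono fun ω hω k => (hω k).1
  obtain ⟨C, R⟩ := S.exists_isPerturbedRecursion hmeas hA1 hA2 ha hb hlam ha_anti hb_anti
    hlam_anti hρ₀.le (pow_nonneg hρ₀.le _) h_int hlap (hb2.mono fun ω hω k => (hω k).2)
  -- `(a + b)² ≤ 2 (a² + b²)` brings the gains into the single rate of the abstract recursion.
  have hsum : Summable fun k => (S.a k + S.b k) ^ 2 + S.lam k := by
    refine Summable.of_nonneg_of_le (fun k => add_nonneg (sq_nonneg _) (hlam k)) (fun k => ?_)
      (h_sum.mul_left 2)
    nlinarith [sq_nonneg (S.a k - S.b k), hlam k]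
  filter_upwards [R.tendsto_zero hh hsum
    (S.infoEig_mul_le hmeas h_int hlap hρ₀.le ha hb R) h_exc h_inf] with ω hω i
  rw [tendsto_iff_norm_sub_tendsto_zero]
  exact squeeze_zero (fun _ => norm_nonneg _) (fun k => S.norm_est_sub_le k ω i)
    (tendsto_zero_iff_norm_tendsto_zero.1 hω)
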